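/- Let $M$ be a compact Hausdorff $C^1$ manifold without boundary, of dimension $d\ge 1$, endowed with a continuous Riemannian metric (for example any compact smooth Riemannian surface), and let $T:M\to M$ be a $C^1$ diffeomorphism. Write $\|D_xT^n\|$ for the operator norm of $D_xT^n:T_xM\to T_{T^nx}M$ with respect to the Riemannian norms and $\log^+t=\max(\log t,0)$. Let $\mathcal M(M,T)$ be the set of $T$-invariant Borel probability measures with the weak star topology. For $x\in M$ and $v\in T_xM\setminus\{0\}$ the Lyapunov exponent of $v$ is $\limsup_{n\to+\infty}\frac1n\log\|D_xT^n(v)\|$. For an ergodic $\nu\in\mathcal M(M,T)$ let $\chi^+(\nu)$ be the largest Lyapunov exponent of $\nu$, that is, the real number which for $\nu$-almost every $x$ is the largest of the Lyapunov exponents of the nonzero vectors of $T_xM$; put $\chi_0^+(\nu)=\max(\chi^+(\nu),0)$. An ergodic decomposition of $\mu\in\mathcal M(M,T)$ is a Borel probability measure $P$ on $\mathcal M(M,T)$, carried by the ergodic measures, with $\mu(B)=\int\nu(B)\,dP(\nu)$ for every Borel set $B\subset M$. The harmonic extension of $\chi_0^+$ is $\overline{\chi_0^+}(\mu)=\int\chi_0^+(\nu)\,dM_\mu(\nu)$,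 where $M_\mu$ is the ergodic decomposition of $\mu$. These objects are well defined: $\chi^+(\nu)$ exists for every ergodic $\nu$; every $\mu\in\mathcal M(M,T)$ has an ergodic decomposition; and for every ergodic decomposition $P$ of $\mu$ the function $\chi_0^+$ is $P$-integrable and $\int\chi_0^+\,dP=\overline{\chi_0^+}(\mu)$. Moreover, for all $\mu\in\mathcal M(M,T)$, $$\overline{\chi_0^+}(\mu)=\inf_{n\ge 1}\frac1n\int_M\log^+\|D_xT^n\|\,d\mu(x).$$ In particular $\overline{\chi_0^+}:\mathcal M(M,T)\to\mathbb R$ is upper semicontinuous. -/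

import Mathlib

open MeasureTheory Filter Topology Bundle
open scoped Manifold ContDiff

/-- The space of `T`-invariant Borel probability measures on `X`. -/
def InvariantMeasure {X : Type*} [MeasurableSpace X] (T : X → X) : Type _ :=
  {μ : ProbabilityMeasure X // MeasurePreserving T (μ : Measure X) (μ : Measure X)}

namespace InvariantMeasure

variable {X : Type*} [MeasurableSpace X] {T : X → X}

/-- The measure on `X` underlying an invariant measure. -/
def toMeasure (μ : InvariantMeasure T) : Measure X := (μ.1 : Measure X)

/-- The weak star topology: the coarsest one for which `μ ↦ ∫ f dμ` is continuous for every
bounded continuous `f` (inherited from Mathlib's topology on probability measures). -/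
instance [TopologicalSpace X] [OpensMeasurableSpace X] : TopologicalSpace (InvariantMeasure T) :=
  inferInstanceAs (TopologicalSpace
    {μ : ProbabilityMeasure X // MeasurePreserving T (μ : Measure X) (μ : Measure X)})

/-- The Borel σ-algebra of the weak star topology. -/
instance [TopologicalSpace X] [OpensMeasurableSpace X] : MeasurableSpace (InvariantMeasure T) :=
  borel _

instance [TopologicalSpace X] [OpensMeasurableSpace X] : BorelSpace (InvariantMeasure T) := ⟨rfl⟩

/-- `P` is an ergodic decomposition of `μ`: a Borel probability measure on the space of invariant
measures, carried by the ergodic ones, with `μ(B) = ∫ ν(B) dP(ν)` for all Borel sets `B`. -/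
structure IsErgodicDecomposition [TopologicalSpace X] [OpensMeasurableSpace X]
    (μ : InvariantMeasure T) (P : Measure (InvariantMeasure T)) : Prop where
  isProbabilityMeasure : IsProbabilityMeasure P
  ae_ergodic : ∀ᵐ ν ∂P, Ergodic T ν.toMeasure
  barycenter : ∀ B : Set X, MeasurableSet B → μ.toMeasure B = ∫⁻ ν, ν.toMeasure B ∂P

open Classical in
/-- The harmonic extension `μ ↦ ∫ f(ν) dM_μ(ν)` of a function `f` on ergodic measures, where `M_μ`
is the ergodic decomposition of `μ`. The values of `f` at non-ergodic measures play no role. -/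
noncomputable def harmonicExtension [TopologicalSpace X] [OpensMeasurableSpace X]
    (f : InvariantMeasure T → ℝ) (μ : InvariantMeasure T) : ℝ :=
  if h : ∃ P : Measure (InvariantMeasure T), IsErgodicDecomposition μ P then
    ∫ ν, f ν ∂h.choose
  else 0

end InvariantMeasure

section Lyapunov

variable {d : ℕ} {M : Type*} [TopologicalSpace M] [ChartedSpace (EuclideanSpace ℝ (Fin d)) M]
  [RiemannianBundle (fun x : M ↦ TangentSpace (𝓡 d) x)]

/-- The (forward) Lyapunov exponent of the tangent vector `v` at `x`,
`limsup (1/n) log ‖D_x T^n v‖`, the norm being the Riemannian one at `T^n x`. -/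
noncomputable def lyapunovExponent (T : M → M) (x : M) (v : TangentSpace (𝓡 d) x) : ℝ :=
  limsup (fun n : ℕ ↦ (n : ℝ)⁻¹ * Real.log ‖mfderiv (𝓡 d) (𝓡 d) T^[n] x v‖) atTop

/-- `c` is the largest Lyapunov exponent of the measure `ν`: at `ν`-almost every point, it is the
largest of the Lyapunov exponents of nonzero tangent vectors. -/
def IsLargestLyapunovExponent [MeasurableSpace M] (T : M → M) (ν : Measure M) (c : ℝ) : Prop :=
  ∀ᵐ x ∂ν, IsGreatest
    {χ : ℝ | ∃ v : TangentSpace (𝓡 d) x, v ≠ 0 ∧ lyapunovExponent T x v = χ} c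

open Classical in
/-- The largest Lyapunov exponent `χ⁺(ν)` of an ergodic measure `ν`. -/
noncomputable def largestLyapunovExponent [MeasurableSpace M] (T : M → M) (ν : Measure M) : ℝ :=
  if h : ∃ c : ℝ, IsLargestLyapunovExponent (d := d) T ν c then h.choose else 0

/-- `χ₀⁺(ν) = max (χ⁺(ν), 0)`. -/
noncomputable def chiZeroPlus [MeasurableSpace M] (T : M → M) (ν : InvariantMeasure T) : ℝ :=
  max (largestLyapunovExponent (d := d) T ν.toMeasure) 0

end Lyapunov

/-! Put $f_n(x)=\log^+\|D_xT^n\|$ and $\Lambda(\mu)=\inf_{n\ge1}\frac1n\int f_n\,d\mu$. The $f_n$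
are continuous, nonnegative, subadditive along orbits and bounded by $nK$, since $DT$ and its
inverse are bounded on the compact $M$ (`exists_norm_mfderiv_iterate_le`). As an infimum of
continuous functions of $\mu$, $\Lambda$ is upper semicontinuous, so everything reduces to two
facts.

$\Lambda=\chi_0^+$ on ergodic measures. Kingman's theorem (`IsSubadditiveCocycle.ae_limsup_eq`) says
that $\limsup\frac1nf_n=\Lambda(\nu)$ almost everywhere; only the upper limit is needed, which
leaves a short proof from Birkhoff's theorem. Since tangent spaces have finite dimension, the growth
rate of $\|D_xT^n\|$ is attained on a basis vector, so it is the largest exponent at $x$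
(`isGreatest_limsup_log_norm`).

$\Lambda$ is harmonic. By Fekete's lemma the infimum is a limit, and each $\mu\mapsto\frac1n\int
f_n\,d\mu$ satisfies the barycenter formula; dominated convergence passes to the limit
(`IsErgodicDecomposition.integral_iInf_inv_mul_integral`). This holds for every ergodic
decomposition, so the integral of $\chi_0^+$ does not depend on the one chosen and uniqueness is not
needed.

An ergodic decomposition is the law of the conditional measures of $\mu$ given the invariant
σ-algebra. Their invariance and ergodicity are expressed by countably many integral conditions, each
valid almost everywhere by Birkhoff's theorem. -/

section Birkhoff

/-! ### Birkhoff's ergodic theorem for bounded functions. -/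

theorem abs_birkhoffAverage_le {X : Type*} {T : X → X} {g : X → ℝ} {C : ℝ} (hC : ∀ x, |g x| ≤ C)
    (hC0 : 0 ≤ C) (n : ℕ) (x : X) : |birkhoffAverage ℝ T g n x| ≤ C := by
  rcases Nat.eq_zero_or_pos n with rfl | hn
  · simpa using hC0
  have hn' : (0 : ℝ) < n := by exact_mod_cast hn
  rw [birkhoffAverage, smul_eq_mul, abs_mul, abs_of_pos (inv_pos.2 hn'), inv_mul_le_iff₀ hn']
  calc |birkhoffSum T g n x| ≤ ∑ k ∈ Finset.range n, |g (T^[k] x)| :=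
        Finset.abs_sum_le_sum_abs _ _
    _ ≤ ∑ k ∈ Finset.range n, C := Finset.sum_le_sum fun k _ ↦ hC _
    _ = n * C := by simp

theorem continuous_birkhoffAverage {X : Type*} [TopologicalSpace X] {T : X → X}
    (hT : Continuous T) {f : X → ℝ} (hf : Continuous f) (n : ℕ) :
    Continuous (birkhoffAverage ℝ T f n) := by
  have : Continuous fun x ↦ ∑ j ∈ Finset.range n, f (T^[j] x) :=
    continuous_finsetSum _ fun j _ ↦ hf.comp (hT.iterate j)
  exact this.const_smul (n : ℝ)⁻¹

variable {X : Type*} [MeasurableSpace X] {T : X → X} {μ : Measure X}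

theorem measurable_birkhoffSum {g : X → ℝ} (hT : Measurable T) (hg : Measurable g) (n : ℕ) :
    Measurable (birkhoffSum T g n) :=
  Finset.measurable_fun_sum _ fun k _ ↦ hg.comp (hT.iterate k)

theorem measurable_birkhoffAverage {g : X → ℝ} (hT : Measurable T) (hg : Measurable g) (n : ℕ) :
    Measurable (birkhoffAverage ℝ T g n) :=
  (measurable_birkhoffSum hT hg n).const_smul ((n : ℝ)⁻¹)

theorem integrable_birkhoffSum {g : X → ℝ} (hT : MeasurePreserving T μ μ) (hg : Integrable g μ)
    (n : ℕ) : Integrable (birkhoffSum T g n) μ :=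
  integrable_finsetSum _ fun k _ ↦ (hT.iterate k).integrable_comp_of_integrable hg

theorem integral_comp_of_measurePreserving {g : X → ℝ} (hT : MeasurePreserving T μ μ)
    (hg : Measurable g) : ∫ x, g (T x) ∂μ = ∫ x, g x ∂μ := by
  have := integral_map (μ := μ) hT.measurable.aemeasurable (f := g) hg.aestronglyMeasurable
  rw [hT.map_eq] at this
  exact this.symm

theorem integral_birkhoffAverage {g : X → ℝ} (hT : MeasurePreserving T μ μ) (hgm : Measurable g)
    (hg : Integrable g μ) {n : ℕ} (hn : n ≠ 0) :
    ∫ x, birkhoffAverage ℝ T g n x ∂μ = ∫ x, g x ∂μ := by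
  have hk : ∀ k, Integrable (fun x ↦ g (T^[k] x)) μ := fun k ↦
    (hT.iterate k).integrable_comp_of_integrable hg
  simp only [birkhoffAverage, birkhoffSum, smul_eq_mul]
  rw [integral_const_mul, integral_finsetSum _ fun k _ ↦ hk k]
  simp only [integral_comp_of_measurePreserving (hT.iterate _) hgm]
  have : (n : ℝ) ≠ 0 := by exact_mod_cast hn
  simp; field_simp

/-- Maximal ergodic inequality, for the maximum of finitely many Birkhoff sums. -/
theorem setIntegral_nonneg_of_partialSups_birkhoffSum_pos {g : X → ℝ}
    (hT : MeasurePreserving T μ μ) (hgm : Measurable g) (hg : Integrable g μ) (N : ℕ) :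
    0 ≤ ∫ x in {x | 0 < partialSups (birkhoffSum T g) N x}, g x ∂μ := by
  set F : X → ℝ := partialSups (birkhoffSum T g) N with hF
  have hFm : Measurable F := by
    rw [hF]
    induction N with
    | zero => simpa using! measurable_birkhoffSum hT.measurable hgm 0
    | succ n ih =>
      rw [partialSups_add_one]
      exact (ih rfl).sup (measurable_birkhoffSum hT.measurable hgm _)
  have hFi : Integrable F μ := by
    rw [hF]
    clear hFm
    clear_value F
    clear hF
    induction N with
    | zero => simp
    | succ n ih =>
      rw [partialSups_add_one]
      exact ih.sup (integrable_birkhoffSum hT hg _)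
  have hle : ∀ n ≤ N, ∀ x, birkhoffSum T g n x ≤ F x := fun n hn x ↦
    le_partialSups_of_le (birkhoffSum T g) hn x
  have hF0 : ∀ x, 0 ≤ F x := fun x ↦ by simpa using hle 0 (Nat.zero_le _) x
  -- Where the maximum is positive it is attained at some $n\ge1$, and $S_{n}g=g+S_{n-1}g\circ T$.
  have hkey : ∀ x, 0 < F x → F x ≤ g x + F (T x) := by
    intro x hx
    have : ∀ n ≤ N, birkhoffSum T g n x ≤ max 0 (g x + F (T x)) := by
      intro n hn
      cases n with
      | zero => simp
      | succ n =>
        rw [birkhoffSum_succ']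
        have := hle n (by lia) (T x)
        exact le_max_of_le_right (by linarith)
    have h2 : F x ≤ max 0 (g x + F (T x)) := by
      rw [hF, Pi.partialSups_apply]
      exact partialSups_le _ _ _ this
    rcases le_max_iff.1 h2 with h | h
    · exact absurd hx (not_lt.2 h)
    · exact h
  set A := {x | 0 < F x} with hA
  have hAm : MeasurableSet A := measurableSet_lt measurable_const hFm
  have hFT : Integrable (fun x ↦ F (T x)) μ := hT.integrable_comp_of_integrable hFi
  calc (0 : ℝ) = ∫ x, F x ∂μ - ∫ x, F (T x) ∂μ := by
        rw [integral_comp_of_measurePreserving hT hFm, sub_self]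
    _ ≤ ∫ x in A, F x ∂μ - ∫ x in A, F (T x) ∂μ := by
        have h1 : ∫ x in A, F x ∂μ = ∫ x, F x ∂μ :=
          setIntegral_eq_integral_of_forall_compl_eq_zero fun x hx ↦
            le_antisymm (not_lt.1 hx) (hF0 x)
        have h2 : ∫ x in A, F (T x) ∂μ ≤ ∫ x, F (T x) ∂μ :=
          setIntegral_le_integral hFT (ae_of_all _ fun x ↦ hF0 _)
        linarith
    _ = ∫ x in A, (F x - F (T x)) ∂μ := (integral_sub hFi.integrableOn hFT.integrableOn).symm
    _ ≤ ∫ x in A, g x ∂μ :=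
        setIntegral_mono_on (hFi.sub hFT).integrableOn hg.integrableOn hAm fun x hx ↦ by
          have := hkey x hx; linarith

/-- Maximal ergodic inequality. -/
theorem setIntegral_nonneg_of_exists_birkhoffSum_pos {g : X → ℝ}
    (hT : MeasurePreserving T μ μ) (hgm : Measurable g) (hg : Integrable g μ) :
    0 ≤ ∫ x in {x | ∃ n, 0 < birkhoffSum T g n x}, g x ∂μ := by
  have hunion : {x | ∃ n, 0 < birkhoffSum T g n x} =
      ⋃ N, {x | 0 < partialSups (birkhoffSum T g) N x} := by
    ext x
    simp only [Set.mem_ofPred_eq, Set.mem_iUnion]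
    constructor
    · rintro ⟨n, hn⟩
      exact ⟨n, hn.trans_le (le_partialSups (birkhoffSum T g) n x)⟩
    · rintro ⟨N, hN⟩
      by_contra! h
      apply absurd hN (not_lt.2 _)
      rw [Pi.partialSups_apply]
      exact partialSups_le _ _ _ fun k _ ↦ h k
  rw [hunion]
  have hm : ∀ N, Measurable (partialSups (birkhoffSum T g) N) := by
    intro N
    induction N with
    | zero => simpa using measurable_birkhoffSum hT.measurable hgm 0
    | succ n ih =>
      rw [partialSups_add_one]
      exact ih.sup (measurable_birkhoffSum hT.measurable hgm _)
  refine ge_of_tendsto' (tendsto_setIntegral_of_monotone (μ := μ) (f := g)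
    (fun N ↦ measurableSet_lt measurable_const (hm N)) ?_ hg.integrableOn) fun N ↦
    setIntegral_nonneg_of_partialSups_birkhoffSum_pos hT hgm hg N
  intro a b hab x hx
  exact lt_of_lt_of_le hx ((partialSups (birkhoffSum T g)).mono hab x)

/-- The maximal inequality is applied to $1_Ag$: by invariance its Birkhoff sums are those of $g$ on
$A$ and vanish off $A$. -/
theorem setIntegral_nonneg_of_invariant {g : X → ℝ} {A : Set X}
    (hT : MeasurePreserving T μ μ) (hgm : Measurable g) (hg : Integrable g μ)
    (hAm : MeasurableSet A) (hA : T ⁻¹' A = A)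
    (hpos : ∀ x ∈ A, ∃ n, 0 < birkhoffSum T g n x) :
    0 ≤ ∫ x in A, g x ∂μ := by
  have hit : ∀ k x, T^[k] x ∈ A ↔ x ∈ A := by
    intro k
    induction k with
    | zero => simp
    | succ k ih =>
      intro x
      rw [Function.iterate_succ_apply, ih, ← Set.mem_preimage, hA]
  have h := setIntegral_nonneg_of_exists_birkhoffSum_pos hT (hgm.indicator hAm) (hg.indicator hAm)
  have hset : {x | ∃ n, 0 < birkhoffSum T (A.indicator g) n x} = A := by
    ext x
    by_cases hx : x ∈ A
    · simp only [Set.mem_ofPred_eq, hx, iff_true]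
      obtain ⟨n, hn⟩ := hpos x hx
      refine ⟨n, hn.trans_eq ?_⟩
      exact Finset.sum_congr rfl fun k _ ↦ (Set.indicator_of_mem ((hit k x).2 hx) g).symm
    · simp only [Set.mem_ofPred_eq, hx, iff_false, not_exists, not_lt]
      intro n
      refine le_of_eq (Finset.sum_eq_zero fun k _ ↦ Set.indicator_of_notMem ?_ g)
      rwa [hit]
  rw [hset, setIntegral_indicator hAm, Set.inter_self] at h
  exact h

/-- The exceptional set $A$ is invariant and on it some Birkhoff sum of $f-h-\varepsilon$ is
positive, so the maximal inequality gives $0\le-\varepsilon\mu(A)$. Leaving $h$ abstract covers both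
the conditional expectation and, for ergodic measures, the constant $\int f$. -/
theorem ae_eventually_birkhoffAverage_le [IsFiniteMeasure μ] {f h : X → ℝ} {C : ℝ}
    (hT : MeasurePreserving T μ μ) (hf : Measurable f) (hC : ∀ x, |f x| ≤ C)
    (hhm : Measurable h) (hhT : h ∘ T = h) (hhi : Integrable h μ)
    (hh : ∀ A, MeasurableSet A → T ⁻¹' A = A → ∫ x in A, h x ∂μ = ∫ x in A, f x ∂μ)
    {ε : ℝ} (hε : 0 < ε) :
    ∀ᵐ x ∂μ, ∀ r : ℚ, h x + ε < r → ∀ᶠ n in atTop, birkhoffAverage ℝ T f n x ≤ r := by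
  set A := {x | ∃ r : ℚ, h x + ε < r ∧ ∃ᶠ n in atTop, (r : ℝ) < birkhoffAverage ℝ T f n x}
    with hA
  have hfi : Integrable f μ := Integrable.of_bound hf.aestronglyMeasurable C (ae_of_all _ hC)
  have hAm : MeasurableSet A := by
    have : A = ⋃ r : ℚ, {x | h x + ε < r} ∩
        ⋂ N : ℕ, ⋃ n : ℕ, {x | N ≤ n ∧ (r : ℝ) < birkhoffAverage ℝ T f n x} := by
      ext x; simp [hA, frequently_atTop]
    rw [this]
    refine MeasurableSet.iUnion fun r ↦ (measurableSet_lt (hhm.add_const _) measurable_const).inter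
      (MeasurableSet.iInter fun N ↦ MeasurableSet.iUnion fun n ↦ ?_)
    exact (MeasurableSet.const _).inter
      (measurableSet_lt measurable_const (measurable_birkhoffAverage hT.measurable hf n))
  have hb : Bornology.IsBounded (Set.range f) := by
    rw [isBounded_iff_forall_norm_le]
    exact ⟨C, by rintro _ ⟨x, rfl⟩; exact hC x⟩
  have hlim := fun x ↦ tendsto_birkhoffAverage_apply_sub_birkhoffAverage' ℝ hb T x
  -- The averages at $x$ and $Tx$ differ by a null sequence, which is absorbed by moving the
  -- threshold from `r` to a smaller rational `r'`.
  have hAT : T ⁻¹' A = A := by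
    ext x
    have hx : h (T x) = h x := congrFun hhT x
    simp only [hA, Set.preimage_ofPred_eq, Set.mem_ofPred_eq, hx]
    constructor
    · rintro ⟨r, hr, hfr⟩
      obtain ⟨r', h1, h2⟩ := exists_rat_btwn hr
      refine ⟨r', h1, ?_⟩
      have := (hlim x).eventually (gt_mem_nhds (sub_pos.2 h2))
      exact (hfr.and_eventually this).mono fun n hn ↦ by linarith [hn.1, hn.2]
    · rintro ⟨r, hr, hfr⟩
      obtain ⟨r', h1, h2⟩ := exists_rat_btwn hr
      refine ⟨r', h1, ?_⟩
      have := (hlim x).eventually (lt_mem_nhds (show (r' : ℝ) - r < 0 by linarith))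
      exact (hfr.and_eventually this).mono fun n hn ↦ by linarith [hn.1, hn.2]
  have hiter : ∀ k x, h (T^[k] x) = h x := by
    intro k
    induction k with
    | zero => simp
    | succ k ih => intro x; rw [Function.iterate_succ_apply, ih]; exact congrFun hhT x
  have hpos : ∀ x ∈ A, ∃ n, 0 < birkhoffSum T (fun x ↦ f x - h x - ε) n x := by
    rintro x ⟨r, hr, hfr⟩
    obtain ⟨n, hn, hn0⟩ := (hfr.and_eventually (eventually_gt_atTop 0)).exists
    refine ⟨n, ?_⟩
    have hn' : (0 : ℝ) < n := by exact_mod_cast hn0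
    have e : birkhoffSum T (fun x ↦ f x - h x - ε) n x = birkhoffSum T f n x - n * (h x + ε) := by
      simp only [birkhoffSum, Finset.sum_sub_distrib, hiter]
      simp; ring
    rw [e]
    rw [birkhoffAverage, smul_eq_mul, lt_inv_mul_iff₀ hn'] at hn
    nlinarith
  have h0 := setIntegral_nonneg_of_invariant hT ((hf.sub hhm).sub_const ε)
    ((hfi.sub hhi).sub (integrable_const ε)) hAm hAT hpos
  have h1 : ∫ x in A, (f x - h x - ε) ∂μ = - (μ.real A * ε) := by
    have h3 : Integrable (fun x ↦ f x - h x) μ := hfi.sub hhi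
    rw [integral_sub h3.integrableOn (integrable_const ε),
      integral_sub hfi.integrableOn hhi.integrableOn, hh A hAm hAT]
    simp
  have hμA : μ A = 0 := by
    have : μ.real A * ε ≤ 0 := by
      have := h0.trans_eq h1
      linarith
    have h3 : μ.real A = 0 := le_antisymm (by nlinarith) measureReal_nonneg
    exact (measureReal_eq_zero_iff).1 h3
  have : ∀ᵐ x ∂μ, x ∉ A := measure_eq_zero_iff_ae_notMem.1 hμA
  filter_upwards [this] with x hx r hr
  by_contra hcon
  exact hx ⟨r, hr, by simpa [Filter.Frequently, not_lt] using hcon⟩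

theorem ae_tendsto_birkhoffAverage_of_setIntegral_eq [IsFiniteMeasure μ] {f h : X → ℝ} {C : ℝ}
    (hT : MeasurePreserving T μ μ) (hf : Measurable f) (hC : ∀ x, |f x| ≤ C)
    (hhm : Measurable h) (hhT : h ∘ T = h) (hhi : Integrable h μ)
    (hh : ∀ A, MeasurableSet A → T ⁻¹' A = A → ∫ x in A, h x ∂μ = ∫ x in A, f x ∂μ) :
    ∀ᵐ x ∂μ, Tendsto (fun n ↦ birkhoffAverage ℝ T f n x) atTop (𝓝 (h x)) := by
  have hup : ∀ k : ℕ, _ := fun k ↦ ae_eventually_birkhoffAverage_le hT hf hC hhm hhT hhi hh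
    (Nat.one_div_pos_of_nat (α := ℝ) (n := k))
  have hdn : ∀ k : ℕ, _ := fun k ↦ ae_eventually_birkhoffAverage_le (f := -f) (h := -h) hT hf.neg
    (fun x ↦ by simpa using hC x) hhm.neg (funext fun x ↦ congrArg Neg.neg (congrFun hhT x)) hhi.neg
    (fun A hA hA' ↦ by simp [integral_neg, hh A hA hA'])
    (Nat.one_div_pos_of_nat (α := ℝ) (n := k))
  filter_upwards [ae_all_iff.2 hup, ae_all_iff.2 hdn] with x h1 h2
  refine tendsto_order.2 ⟨fun a ha ↦ ?_, fun a ha ↦ ?_⟩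
  · obtain ⟨r, hr1, hr2⟩ := exists_rat_btwn (neg_lt_neg ha)
    obtain ⟨k, hk⟩ := exists_nat_one_div_lt (sub_pos.2 hr1)
    filter_upwards [h2 k r (by simp only [Pi.neg_apply]; linarith)] with n hn
    have e : birkhoffAverage ℝ T (-f) n x = - birkhoffAverage ℝ T f n x := by
      simp [birkhoffAverage, birkhoffSum]
    rw [e] at hn
    linarith
  · obtain ⟨r, hr1, hr2⟩ := exists_rat_btwn ha
    obtain ⟨k, hk⟩ := exists_nat_one_div_lt (sub_pos.2 hr1)
    filter_upwards [h1 k r (by linarith)] with n hn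
    linarith

/-- Birkhoff's pointwise ergodic theorem for bounded functions. -/
theorem ae_tendsto_birkhoffAverage [IsFiniteMeasure μ] {f : X → ℝ} {C : ℝ}
    (hT : MeasurePreserving T μ μ) (hf : Measurable f) (hC : ∀ x, |f x| ≤ C) :
    ∀ᵐ x ∂μ, Tendsto (fun n ↦ birkhoffAverage ℝ T f n x) atTop
      (𝓝 ((μ[f | MeasurableSpace.invariants T]) x)) := by
  have hm := MeasurableSpace.invariants_le T
  have hfi : Integrable f μ := Integrable.of_bound hf.aestronglyMeasurable C (ae_of_all _ hC)
  have hsm : Measurable[MeasurableSpace.invariants T] (μ[f | MeasurableSpace.invariants T]) :=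
    stronglyMeasurable_condExp.measurable
  exact ae_tendsto_birkhoffAverage_of_setIntegral_eq hT hf hC (hsm.mono hm le_rfl)
    (MeasurableSpace.comp_eq_of_measurable_invariants hsm) integrable_condExp
    fun A hA hA' ↦ setIntegral_condExp hm hfi (MeasurableSpace.measurableSet_invariants.2 ⟨hA, hA'⟩)

theorem Ergodic.ae_tendsto_birkhoffAverage [IsProbabilityMeasure μ] {f : X → ℝ} {C : ℝ}
    (hT : Ergodic T μ) (hf : Measurable f) (hC : ∀ x, |f x| ≤ C) :
    ∀ᵐ x ∂μ, Tendsto (fun n ↦ birkhoffAverage ℝ T f n x) atTop (𝓝 (∫ y, f y ∂μ)) := by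
  refine ae_tendsto_birkhoffAverage_of_setIntegral_eq hT.toMeasurePreserving hf hC
    measurable_const rfl (integrable_const _) fun A hA hA' ↦ ?_
  rcases hT.toPreErgodic.ae_empty_or_univ hA hA' with h | h
  · rw [setIntegral_congr_set h, setIntegral_congr_set h]; simp
  · rw [setIntegral_congr_set h, setIntegral_congr_set h]; simp

end Birkhoff

/-! ### The weak star topology on invariant measures, barycenters, and a test for ergodicity. -/

namespace InvariantMeasure

instance {X : Type*} [MeasurableSpace X] {T : X → X} (μ : InvariantMeasure T) :
    IsProbabilityMeasure μ.toMeasure := μ.1.2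

theorem measurePreserving {X : Type*} [MeasurableSpace X] {T : X → X} (μ : InvariantMeasure T) :
    MeasurePreserving T μ.toMeasure μ.toMeasure := μ.2

section WeakStar

variable {X : Type*} [TopologicalSpace X] [MeasurableSpace X] [BorelSpace X] {T : X → X}

theorem continuous_integral [CompactSpace X] (f : C(X, ℝ)) :
    Continuous fun ν : InvariantMeasure T ↦ ∫ x, f x ∂ν.toMeasure :=
  (ProbabilityMeasure.continuous_integral_continuousMap f).comp continuous_subtype_val

/-- Closed sets form a generating π-system, and their indicators are limits of continuous functions,
whose integrals are weak star continuous. -/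
theorem measurable_toMeasure [HasOuterApproxClosed X] :
    Measurable (toMeasure : InvariantMeasure T → Measure X) := by
  refine Measurable.measure_of_isPiSystem_of_isProbabilityMeasure
    (BorelSpace.measurable_eq.trans borel_eq_generateFrom_isClosed) isPiSystem_isClosed
    fun F hF ↦ ?_
  refine measurable_of_tendsto_metrizable (f := fun n (ν : InvariantMeasure T) ↦
    ∫⁻ x, (IsClosed.apprSeq hF n x : ENNReal) ∂ν.toMeasure) (fun n ↦ ?_) ?_
  · have h : Continuous fun ν : ProbabilityMeasure X ↦
        ∫⁻ x, (IsClosed.apprSeq hF n x : ENNReal) ∂(ν : Measure X) :=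
      ProbabilityMeasure.continuous_lintegral_boundedContinuousFunction _
    have h' : Continuous fun ν : InvariantMeasure T ↦
      ∫⁻ x, (IsClosed.apprSeq hF n x : ENNReal) ∂ν.toMeasure := h.comp continuous_subtype_val
    exact h'.measurable
  · exact tendsto_pi_nhds.2 fun ν ↦ HasOuterApproxClosed.tendsto_lintegral_apprSeq hF ν.toMeasure

variable [CompactSpace X]

theorem integrable_continuousMap (f : C(X, ℝ)) (ν : Measure X) [IsFiniteMeasure ν] :
    Integrable f ν :=
  Integrable.of_bound f.continuous.aestronglyMeasurable ‖f‖ (ae_of_all _ f.norm_coe_le_norm)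

variable [T2Space X] [SecondCountableTopology X]

/-- Integration is Lipschitz on $C(X)$, so a dense sequence suffices. This is what turns identities
between measures into countably many conditions. -/
theorem eq_of_integral_denseSeq_eq {ν ν' : Measure X} [IsFiniteMeasure ν] [IsFiniteMeasure ν']
    (h : ∀ k, ∫ x, TopologicalSpace.denseSeq C(X, ℝ) k x ∂ν =
      ∫ x, TopologicalSpace.denseSeq C(X, ℝ) k x ∂ν') : ν = ν' := by
  have hc : ∀ (ρ : Measure X) [IsFiniteMeasure ρ], Continuous fun f : C(X, ℝ) ↦ ∫ x, f x ∂ρ := by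
    intro ρ _
    suffices h : LipschitzWith ⟨ρ.real Set.univ, measureReal_nonneg⟩
      fun f : C(X, ℝ) ↦ ∫ x, f x ∂ρ from h.continuous
    refine LipschitzWith.of_dist_le_mul fun f g ↦ ?_
    have hf := integrable_continuousMap f ρ
    have hg := integrable_continuousMap g ρ
    rw [Real.dist_eq, ← integral_sub hf hg, mul_comm]
    exact norm_integral_le_of_norm_le_const (μ := ρ) (f := fun x ↦ f x - g x) (C := dist f g)
      (ae_of_all _ fun x ↦ by rw [← dist_eq_norm]; exact ContinuousMap.dist_apply_le_dist x)
  have heq : (fun f : C(X, ℝ) ↦ ∫ x, f x ∂ν) = fun f ↦ ∫ x, f x ∂ν' :=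
    (hc ν).ext_on (TopologicalSpace.denseRange_denseSeq C(X, ℝ)) (hc ν') (by
      rintro _ ⟨k, rfl⟩; exact h k)
  let _ := TopologicalSpace.metrizableSpaceMetric X
  exact ext_of_forall_integral_eq_of_IsFiniteMeasure fun f ↦ congrFun heq f.toContinuousMap

/-- The space of probability measures is compact, so a continuous injection into $\mathbb R^{\mathbb
N}$ is a closed embedding. -/
theorem isInducing_integral_denseSeq :
    IsInducing fun (ν : InvariantMeasure T) k ↦
      ∫ x, TopologicalSpace.denseSeq C(X, ℝ) k x ∂ν.toMeasure := by
  have h : IsClosedEmbedding fun (ν : ProbabilityMeasure X) k ↦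
      ∫ x, TopologicalSpace.denseSeq C(X, ℝ) k x ∂(ν : Measure X) := by
    refine Continuous.isClosedEmbedding (continuous_pi fun k ↦
      ProbabilityMeasure.continuous_integral_continuousMap _) fun ν ν' h ↦ ?_
    have := ν.2
    have := ν'.2
    exact Subtype.ext (eq_of_integral_denseSeq_eq fun k ↦ congrFun h k)
  exact h.isInducing.comp IsInducing.subtypeVal

/-- Maps into the space of invariant measures are measurable as soon as the integrals of
continuous functions are. -/
theorem measurable_of_integral {Ω : Type*} [MeasurableSpace Ω] {Φ : Ω → InvariantMeasure T}
    (h : ∀ f : C(X, ℝ), Measurable fun z ↦ ∫ x, f x ∂(Φ z).toMeasure) : Measurable Φ := by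
  have hb : (borel (InvariantMeasure T)) = MeasurableSpace.comap
      (fun (ν : InvariantMeasure T) k ↦
        ∫ x, TopologicalSpace.denseSeq C(X, ℝ) k x ∂ν.toMeasure) inferInstance := by
    rw [BorelSpace.measurable_eq (α := ℕ → ℝ), ← borel_comap,
      ← (isInducing_integral_denseSeq (T := T)).eq_induced]
  rw [BorelSpace.measurable_eq (α := InvariantMeasure T), hb]
  refine measurable_comap_iff.2 (measurable_pi_iff.2 fun k ↦ h _)

end WeakStar

section Barycenter

variable {X : Type*} [TopologicalSpace X] [MeasurableSpace X] [BorelSpace X] {T : X → X}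
  [HasOuterApproxClosed X]

theorem IsErgodicDecomposition.bind_eq {μ : InvariantMeasure T} {P : Measure (InvariantMeasure T)}
    (h : μ.IsErgodicDecomposition P) : P.bind toMeasure = μ.toMeasure := by
  ext B hB
  rw [Measure.bind_apply hB measurable_toMeasure.aemeasurable, h.barycenter B hB]

theorem IsErgodicDecomposition.integral_integral [CompactSpace X]
    {μ : InvariantMeasure T} {P : Measure (InvariantMeasure T)}
    (h : μ.IsErgodicDecomposition P) (f : C(X, ℝ)) :
    ∫ ν, ∫ x, f x ∂ν.toMeasure ∂P = ∫ x, f x ∂μ.toMeasure := by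
  have hi : Integrable f (P.bind toMeasure) := by
    rw [h.bind_eq]; exact integrable_continuousMap f _
  rw [← h.bind_eq]
  have := h.isProbabilityMeasure
  let κ : ProbabilityTheory.Kernel (InvariantMeasure T) X := ⟨toMeasure, measurable_toMeasure⟩
  change _ = ∫ x, f x ∂(P.bind κ)
  change Integrable f (P.bind κ) at hi
  rw [Measure.comp_eq_comp_const_apply] at hi ⊢
  rw [ProbabilityTheory.Kernel.integral_comp hi]
  rfl

end Barycenter

/-- Integral form of ergodicity: the Birkhoff averages of a dense set of continuous functions have
arbitrarily small variance. -/
theorem ergodic_of_iInf_integral_sq_le {X : Type*} [TopologicalSpace X] [MeasurableSpace X]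
    [BorelSpace X] [CompactSpace X] [T2Space X] [SecondCountableTopology X] {T : X → X}
    (hT : Continuous T) (ν : InvariantMeasure T)
    (h : ∀ k, ⨅ n : ℕ, ∫ x, (birkhoffAverage ℝ T (TopologicalSpace.denseSeq C(X, ℝ) k) (n + 1) x) ^ 2
      ∂ν.toMeasure ≤ (∫ x, TopologicalSpace.denseSeq C(X, ℝ) k x ∂ν.toMeasure) ^ 2) :
    Ergodic T ν.toMeasure := by
  set m := ν.toMeasure with hm
  have hTm : MeasurePreserving T m m := ν.measurePreserving
  refine ⟨hTm, ⟨fun B hB hTB ↦ ?_⟩⟩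
  have hres : MeasurePreserving T (m.restrict B) (m.restrict B) := by
    have := hTm.restrict_preimage hB
    rwa [hTB] at this
  -- Small variance of the averages makes $B$ independent of every continuous function. Evaluating
  -- this equality on $B$ itself gives $m(B)=m(B)^2$.
  have key : m.restrict B = m B • m := by
    have : IsFiniteMeasure (m B • m) := Measure.smul_finite _ (measure_ne_top _ _)
    refine eq_of_integral_denseSeq_eq fun k ↦ ?_
    set f := TopologicalSpace.denseSeq C(X, ℝ) k with hf
    set c := ∫ x, f x ∂m with hc
    rw [integral_smul_measure, ← hc, smul_eq_mul]
    change _ = m.real B * c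
    have hAc : ∀ n, Continuous (birkhoffAverage ℝ T f n) :=
      continuous_birkhoffAverage hT f.continuous
    have hAi : ∀ n, Integrable (birkhoffAverage ℝ T f n) m := fun n ↦
      integrable_continuousMap ⟨_, hAc n⟩ m
    have hA2i : ∀ n, Integrable (fun x ↦ (birkhoffAverage ℝ T f n x) ^ 2) m := fun n ↦
      integrable_continuousMap ⟨fun x ↦ (birkhoffAverage ℝ T f n x) ^ 2, (hAc n).pow 2⟩ m
    have hA1 : ∀ n : ℕ, ∫ x, birkhoffAverage ℝ T f (n + 1) x ∂m = c := fun n ↦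
      integral_birkhoffAverage hTm f.continuous.measurable (integrable_continuousMap f m)
        n.succ_ne_zero
    have hA2 : ∀ n : ℕ, ∫ x in B, birkhoffAverage ℝ T f (n + 1) x ∂m = ∫ x in B, f x ∂m := fun n ↦
      integral_birkhoffAverage hres f.continuous.measurable (integrable_continuousMap f _)
        n.succ_ne_zero
    have hsmall : ∀ ε > 0, |∫ x in B, f x ∂m - m.real B * c| ≤ ε := by
      intro ε hε
      obtain ⟨n, hn⟩ := exists_lt_of_ciInf_lt ((h k).trans_lt (lt_add_of_pos_right _ (pow_pos hε 2)))
      set A := birkhoffAverage ℝ T f (n + 1) with hAdef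
      have hd : Integrable (fun x ↦ A x - c) m := (hAi _).sub (integrable_const c)
      have hd2 : Integrable (fun x ↦ (A x - c) ^ 2) m :=
        integrable_continuousMap ⟨fun x ↦ (A x - c) ^ 2, ((hAc _).sub continuous_const).pow 2⟩ m
      have hvar : ∫ x, (A x - c) ^ 2 ∂m ≤ ε ^ 2 := by
        have e : ∀ x, (A x - c) ^ 2 = A x ^ 2 - 2 * c * A x + c ^ 2 := fun x ↦ by ring
        have hi1 : Integrable (fun x ↦ A x ^ 2) m := hA2i _
        have hi2 : Integrable (fun x ↦ 2 * c * A x) m := (hAi _).const_mul _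
        have hi3 : Integrable (fun x ↦ A x ^ 2 - 2 * c * A x) m := hi1.sub hi2
        simp only [e]
        rw [integral_add hi3 (integrable_const _), integral_sub hi1 hi2, integral_const_mul,
          hA1 n]
        simp only [integral_const, probReal_univ, one_smul]
        have : ∫ x, A x ^ 2 ∂m < c ^ 2 + ε ^ 2 := hn
        nlinarith
      have hB : ∫ x in B, f x ∂m - m.real B * c = ∫ x in B, (A x - c) ∂m := by
        rw [integral_sub (hAi _).integrableOn (integrable_const c).integrableOn, hA2 n]
        simp
      rw [hB]
      calc |∫ x in B, (A x - c) ∂m| ≤ ∫ x in B, |A x - c| ∂m := abs_integral_le_integral_abs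
        _ ≤ ∫ x, |A x - c| ∂m := setIntegral_le_integral hd.abs (ae_of_all _ fun x ↦ abs_nonneg _)
        -- $|t|\le(t^2+\varepsilon^2)/(2\varepsilon)$ replaces the Cauchy–Schwarz inequality.
        _ ≤ ∫ x, ((A x - c) ^ 2 + ε ^ 2) / (2 * ε) ∂m := by
          refine integral_mono hd.abs ((hd2.add (integrable_const _)).div_const _) fun x ↦ ?_
          simp only
          rw [le_div_iff₀ (by positivity)]
          nlinarith [sq_nonneg (|A x - c| - ε), sq_abs (A x - c)]
        _ = (∫ x, (A x - c) ^ 2 ∂m + ε ^ 2) / (2 * ε) := by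
          rw [integral_div, integral_add hd2 (integrable_const _)]
          simp
        _ ≤ ε := by
          rw [div_le_iff₀ (by positivity)]
          nlinarith
    have := le_of_forall_pos_le_add (a := |∫ x in B, f x ∂m - m.real B * c|) (b := 0)
      fun ε hε ↦ by simpa using hsmall ε hε
    exact sub_eq_zero.1 (abs_nonpos_iff.1 this)
  have hBB : m B = m B * m B := by
    have := congrArg (fun ρ : Measure X ↦ ρ B) key
    simpa using this
  have h01 : m B = 0 ∨ m B = 1 := by
    by_cases h0 : m B = 0
    · exact Or.inl h0
    · right
      have : m B * 1 = m B * m B := by rw [mul_one]; exact hBB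
      exact ((ENNReal.mul_right_inj h0 (measure_ne_top _ _)).1 this).symm
  rw [eventuallyConst_set']
  rcases h01 with h0 | h1
  · left; exact ae_eq_empty.2 h0
  · right; exact (ae_eq_univ_iff_measure_eq hB.nullMeasurableSet).2 (by simpa using h1)

end InvariantMeasure

/-! ### Existence of ergodic decompositions. -/

theorem sq_integral_le_integral_sq {X : Type*} [MeasurableSpace X] {ρ : Measure X}
    [IsProbabilityMeasure ρ] {g : X → ℝ} (hg : Integrable g ρ)
    (hg2 : Integrable (fun x ↦ g x ^ 2) ρ) : (∫ x, g x ∂ρ) ^ 2 ≤ ∫ x, g x ^ 2 ∂ρ := by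
  set c := ∫ x, g x ∂ρ with hc
  have h0 : 0 ≤ ∫ x, (g x - c) ^ 2 ∂ρ := integral_nonneg fun x ↦ sq_nonneg _
  have e : ∀ x, (g x - c) ^ 2 = g x ^ 2 - 2 * c * g x + c ^ 2 := fun x ↦ by ring
  have hi2 : Integrable (fun x ↦ 2 * c * g x) ρ := hg.const_mul _
  have hi3 : Integrable (fun x ↦ g x ^ 2 - 2 * c * g x) ρ := hg2.sub hi2
  simp only [e] at h0
  rw [integral_add hi3 (integrable_const _), integral_sub hg2 hi2, integral_const_mul] at h0
  simp only [integral_const, probReal_univ, one_smul, ← hc] at h0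
  nlinarith

namespace InvariantMeasure

/-- The invariant measure given by a probability measure preserved by `T`. -/
def ofMeasurePreserving {X : Type*} [MeasurableSpace X] {T : X → X} (ν : Measure X)
    (h : IsProbabilityMeasure ν) (hν : MeasurePreserving T ν ν) : InvariantMeasure T :=
  ⟨(⟨ν, h⟩ : ProbabilityMeasure X), hν⟩

variable {X : Type*} [TopologicalSpace X] [MeasurableSpace X] [BorelSpace X] [CompactSpace X]
  [T2Space X] [SecondCountableTopology X] {T : X → X}

theorem standardBorelSpace_of_compactSpace : StandardBorelSpace X := by
  let _ := TopologicalSpace.metrizableSpaceMetric X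
  have : PolishSpace X := inferInstance
  infer_instance

section

variable [StandardBorelSpace X] (μ : InvariantMeasure T)

open ProbabilityTheory

/-- The conditional measures of `μ` with respect to the σ-algebra of invariant sets. -/
noncomputable def conditional (x : X) : Measure X :=
  condExpKernel μ.toMeasure (MeasurableSpace.invariants T) x

instance (x : X) : IsProbabilityMeasure (μ.conditional x) := by
  unfold conditional; infer_instance

omit [CompactSpace X] [T2Space X] [SecondCountableTopology X] in
theorem measurable_integral_conditional (f : C(X, ℝ)) :
    Measurable fun x ↦ ∫ y, f y ∂μ.conditional x :=
  (StronglyMeasurable.integral_condExpKernel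
    f.continuous.measurable.stronglyMeasurable).measurable.mono
      (MeasurableSpace.invariants_le T) le_rfl

omit [T2Space X] [SecondCountableTopology X] in
theorem condExp_ae_eq_integral_conditional (f : C(X, ℝ)) :
    μ.toMeasure[f | MeasurableSpace.invariants T] =ᵐ[μ.toMeasure]
      fun x ↦ ∫ y, f y ∂μ.conditional x :=
  condExp_ae_eq_integral_condExpKernel (MeasurableSpace.invariants_le T)
    (integrable_continuousMap f _)

omit [T2Space X] [SecondCountableTopology X] in
theorem integral_integral_conditional (f : C(X, ℝ)) :
    ∫ x, ∫ y, f y ∂μ.conditional x ∂μ.toMeasure = ∫ x, f x ∂μ.toMeasure := by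
  rw [← integral_congr_ae (μ.condExp_ae_eq_integral_conditional f),
    integral_condExp (MeasurableSpace.invariants_le T)]

omit [T2Space X] [SecondCountableTopology X] in
theorem ae_tendsto_birkhoffAverage_conditional (f : C(X, ℝ)) :
    ∀ᵐ x ∂μ.toMeasure, Tendsto (fun n ↦ birkhoffAverage ℝ T f n x) atTop
      (𝓝 (∫ y, f y ∂μ.conditional x)) := by
  filter_upwards [ae_tendsto_birkhoffAverage μ.measurePreserving f.continuous.measurable
    f.norm_coe_le_norm, μ.condExp_ae_eq_integral_conditional f] with x h1 h2
  rwa [← h2]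

omit [T2Space X] [SecondCountableTopology X] in
-- The Birkhoff averages of $f$ and $f\circ T$ have the same limit, and these limits are the two
-- conditional integrals.
theorem ae_integral_comp_conditional (hT : Continuous T) (f : C(X, ℝ)) :
    ∀ᵐ x ∂μ.toMeasure, ∫ y, f (T y) ∂μ.conditional x = ∫ y, f y ∂μ.conditional x := by
  filter_upwards [μ.ae_tendsto_birkhoffAverage_conditional f,
    μ.ae_tendsto_birkhoffAverage_conditional (f.comp ⟨T, hT⟩)] with x h1 h2
  have hb : Bornology.IsBounded (Set.range f) := by
    rw [isBounded_iff_forall_norm_le]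
    exact ⟨‖f‖, by rintro _ ⟨x, rfl⟩; exact f.norm_coe_le_norm x⟩
  have h3 := (tendsto_birkhoffAverage_apply_sub_birkhoffAverage' ℝ hb T x).add h1
  rw [zero_add] at h3
  refine tendsto_nhds_unique (h2.congr fun n ↦ ?_) h3
  simp only [sub_add_cancel, birkhoffAverage, birkhoffSum, ContinuousMap.comp_apply,
    ContinuousMap.coe_mk]
  simp only [← Function.iterate_succ_apply, ← Function.iterate_succ_apply' T]

/-- The points at which the conditional measure is seen to be invariant. -/
def conditionalDomain : Set X :=
  {x | ∀ k, ∫ y, TopologicalSpace.denseSeq C(X, ℝ) k (T y) ∂μ.conditional x =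
    ∫ y, TopologicalSpace.denseSeq C(X, ℝ) k y ∂μ.conditional x}

theorem measurableSet_conditionalDomain (hT : Continuous T) :
    MeasurableSet μ.conditionalDomain := by
  rw [conditionalDomain, Set.ofPred_forall]
  exact MeasurableSet.iInter fun k ↦ measurableSet_eq_fun
    (μ.measurable_integral_conditional ((TopologicalSpace.denseSeq C(X, ℝ) k).comp ⟨T, hT⟩))
    (μ.measurable_integral_conditional _)

theorem ae_mem_conditionalDomain (hT : Continuous T) :
    ∀ᵐ x ∂μ.toMeasure, x ∈ μ.conditionalDomain :=
  ae_all_iff.2 fun _ ↦ μ.ae_integral_comp_conditional hT _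

theorem measurePreserving_conditional (hT : Continuous T) {x : X}
    (hx : x ∈ μ.conditionalDomain) :
    MeasurePreserving T (μ.conditional x) (μ.conditional x) := by
  refine ⟨hT.measurable, ?_⟩
  have := Measure.isProbabilityMeasure_map (μ := μ.conditional x) hT.measurable.aemeasurable
  refine eq_of_integral_denseSeq_eq fun k ↦ ?_
  rw [integral_map hT.measurable.aemeasurable (ContinuousMap.continuous _).aestronglyMeasurable]
  exact hx k

open Classical in
/-- The conditional measures of `μ`, as invariant measures. -/
noncomputable def ergodicComponent (hT : Continuous T) (x : X) : InvariantMeasure T :=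
  if hx : x ∈ μ.conditionalDomain then
    ofMeasurePreserving (μ.conditional x) inferInstance (μ.measurePreserving_conditional hT hx)
  -- Off the domain, a null set, any fixed invariant measure would do.
  else μ

theorem toMeasure_ergodicComponent (hT : Continuous T) {x : X} (hx : x ∈ μ.conditionalDomain) :
    (μ.ergodicComponent hT x).toMeasure = μ.conditional x := by
  rw [ergodicComponent, dif_pos hx]; rfl

theorem measurable_ergodicComponent (hT : Continuous T) :
    Measurable (μ.ergodicComponent hT) := by
  classical
  refine measurable_of_integral fun f ↦ ?_
  have : (fun z ↦ ∫ x, f x ∂(μ.ergodicComponent hT z).toMeasure) = fun z ↦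
      if z ∈ μ.conditionalDomain then ∫ y, f y ∂μ.conditional z else ∫ y, f y ∂μ.toMeasure := by
    funext z
    split_ifs with hz
    · rw [μ.toMeasure_ergodicComponent hT hz]
    · rw [ergodicComponent, dif_neg hz]
  rw [this]
  exact Measurable.ite (μ.measurableSet_conditionalDomain hT)
    (μ.measurable_integral_conditional f) measurable_const

/-- Let $J$ be the left side and $L=\int f\,d\mu_x$, where $\mu_x$ is the conditional measure.
Invariance of $\mu_x$ and nonnegativity of the variance give $J\ge L^2$ almost everywhere, while
$\int J\,d\mu\le\lim_n\int(A_nf)^2\,d\mu=\int L^2\,d\mu$ by Birkhoff's theorem. Hence $J=L^2$ almost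
everywhere. -/
theorem ae_iInf_integral_sq_conditional_le (hT : Continuous T) (f : C(X, ℝ)) :
    ∀ᵐ x ∂μ.toMeasure, ⨅ n : ℕ, ∫ y, (birkhoffAverage ℝ T f (n + 1) y) ^ 2 ∂μ.conditional x ≤
      (∫ y, f y ∂μ.conditional x) ^ 2 := by
  let A2 : ℕ → C(X, ℝ) := fun n ↦
    ⟨fun y ↦ (birkhoffAverage ℝ T f (n + 1) y) ^ 2, (continuous_birkhoffAverage hT f.continuous _).pow 2⟩
  have hA2 : ∀ n y, A2 n y = (birkhoffAverage ℝ T f (n + 1) y) ^ 2 := fun _ _ ↦ rfl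
  have hA2b : ∀ n y, A2 n y ≤ ‖f‖ ^ 2 := fun n y ↦ by
    rw [hA2, ← sq_abs]
    gcongr
    exact abs_birkhoffAverage_le f.norm_coe_le_norm (norm_nonneg _) _ _
  have hA20 : ∀ n y, 0 ≤ A2 n y := fun n y ↦ sq_nonneg _
  have hI0 : ∀ n x, 0 ≤ ∫ y, A2 n y ∂μ.conditional x := fun n x ↦ integral_nonneg (hA20 n)
  have hIb : ∀ n x, ∫ y, A2 n y ∂μ.conditional x ≤ ‖f‖ ^ 2 := fun n x ↦ by
    refine (integral_mono (integrable_continuousMap (A2 n) _) (integrable_const _)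
      (hA2b n)).trans_eq (by simp)
  have hbdd : ∀ x, BddBelow (Set.range fun n ↦ ∫ y, A2 n y ∂μ.conditional x) := fun x ↦
    ⟨0, by rintro _ ⟨n, rfl⟩; exact hI0 n x⟩
  set L : X → ℝ := fun x ↦ ∫ y, f y ∂μ.conditional x with hL
  have hLm : Measurable L := μ.measurable_integral_conditional f
  have hLb : ∀ x, |L x| ≤ ‖f‖ := fun x ↦ by
    have := norm_integral_le_of_norm_le_const (μ := μ.conditional x) (f := f)
      (ae_of_all _ f.norm_coe_le_norm)
    simpa using this
  have hL2i : Integrable (fun x ↦ L x ^ 2) μ.toMeasure :=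
    Integrable.of_bound (hLm.pow_const 2).aestronglyMeasurable (‖f‖ ^ 2) (ae_of_all _ fun x ↦ by
      rw [Real.norm_eq_abs, abs_pow]; exact pow_le_pow_left₀ (abs_nonneg _) (hLb x) 2)
  set J : X → ℝ := fun x ↦ ⨅ n, ∫ y, A2 n y ∂μ.conditional x with hJ
  have hJm : Measurable J := Measurable.iInf fun n ↦ μ.measurable_integral_conditional (A2 n)
  have hJ0 : ∀ x, 0 ≤ J x := fun x ↦ le_ciInf fun n ↦ hI0 n x
  have hJi : Integrable J μ.toMeasure :=
    Integrable.of_bound hJm.aestronglyMeasurable (‖f‖ ^ 2) (ae_of_all _ fun x ↦ by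
      rw [Real.norm_eq_abs, abs_of_nonneg (hJ0 x)]
      exact (ciInf_le (hbdd x) 0).trans (hIb 0 x))
  have hJL : 0 ≤ᵐ[μ.toMeasure] fun x ↦ J x - L x ^ 2 := by
    filter_upwards [μ.ae_mem_conditionalDomain hT] with x hx
    refine sub_nonneg.2 (le_ciInf fun n ↦ ?_)
    rw [hL]
    simp only
    rw [← integral_birkhoffAverage (μ.measurePreserving_conditional hT hx) f.continuous.measurable
      (integrable_continuousMap f _) n.succ_ne_zero]
    exact sq_integral_le_integral_sq
      (integrable_continuousMap ⟨_, continuous_birkhoffAverage hT f.continuous (n + 1)⟩ _)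
      (integrable_continuousMap (A2 n) _)
  have hlim : Tendsto (fun n ↦ ∫ x, A2 n x ∂μ.toMeasure) atTop (𝓝 (∫ x, L x ^ 2 ∂μ.toMeasure)) := by
    refine tendsto_integral_of_dominated_convergence (fun _ ↦ ‖f‖ ^ 2)
      (fun n ↦ (A2 n).continuous.aestronglyMeasurable) (integrable_const _)
      (fun n ↦ ae_of_all _ fun x ↦ ?_) ?_
    · rw [Real.norm_eq_abs, abs_of_nonneg (hA20 n x)]; exact hA2b n x
    · filter_upwards [μ.ae_tendsto_birkhoffAverage_conditional f] with x hx
      exact (hx.comp (tendsto_add_atTop_nat 1)).pow 2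
  have hle : ∫ x, J x ∂μ.toMeasure ≤ ∫ x, L x ^ 2 ∂μ.toMeasure := by
    refine ge_of_tendsto' hlim fun n ↦ ?_
    rw [← μ.integral_integral_conditional (A2 n)]
    exact integral_mono hJi (Integrable.of_bound
      (μ.measurable_integral_conditional (A2 n)).aestronglyMeasurable (‖f‖ ^ 2)
      (ae_of_all _ fun x ↦ by
        rw [Real.norm_eq_abs, abs_of_nonneg (hI0 n x)]; exact hIb n x)) fun x ↦ ciInf_le (hbdd x) n
  have hint0 : ∫ x, (J x - L x ^ 2) ∂μ.toMeasure = 0 := by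
    refine le_antisymm ?_ (integral_nonneg_of_ae hJL)
    rw [integral_sub hJi hL2i]; linarith
  filter_upwards [(integral_eq_zero_iff_of_nonneg_ae hJL (hJi.sub hL2i)).1 hint0] with x hx
  exact (sub_eq_zero.1 hx).le

/-- The variance condition cuts out a Borel set of measures, so it can be checked through the
pushforward; measurability of the set of ergodic measures is not needed. -/
theorem ae_ergodic_ergodicComponent (hT : Continuous T) :
    ∀ᵐ ν ∂μ.toMeasure.map (μ.ergodicComponent hT), Ergodic T ν.toMeasure := by
  have hS : MeasurableSet {ν : InvariantMeasure T | ∀ k, ⨅ n : ℕ,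
      ∫ x, (birkhoffAverage ℝ T (TopologicalSpace.denseSeq C(X, ℝ) k) (n + 1) x) ^ 2 ∂ν.toMeasure ≤
        (∫ x, TopologicalSpace.denseSeq C(X, ℝ) k x ∂ν.toMeasure) ^ 2} := by
    rw [Set.ofPred_forall]
    refine MeasurableSet.iInter fun k ↦ measurableSet_le (Measurable.iInf fun n ↦ ?_)
      ((continuous_integral _).measurable.pow_const 2)
    exact (continuous_integral ⟨_, (continuous_birkhoffAverage hT
      (TopologicalSpace.denseSeq C(X, ℝ) k).continuous (n + 1)).pow 2⟩).measurable
  have h := (ae_map_iff (μ.measurable_ergodicComponent hT).aemeasurable hS).2 (by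
    filter_upwards [μ.ae_mem_conditionalDomain hT, ae_all_iff.2 fun k ↦
      μ.ae_iInf_integral_sq_conditional_le hT (TopologicalSpace.denseSeq C(X, ℝ) k)] with x hx h k
    rw [μ.toMeasure_ergodicComponent hT hx]
    exact h k)
  exact h.mono fun ν hν ↦ ergodic_of_iInf_integral_sq_le hT ν hν

end

/-- Existence of an ergodic decomposition. -/
theorem exists_isErgodicDecomposition (hT : Continuous T) (μ : InvariantMeasure T) :
    ∃ P : Measure (InvariantMeasure T), μ.IsErgodicDecomposition P := by
  have := standardBorelSpace_of_compactSpace (X := X)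
  let _ := TopologicalSpace.metrizableSpaceMetric X
  have hm := MeasurableSpace.invariants_le T
  refine ⟨μ.toMeasure.map (μ.ergodicComponent hT),
    Measure.isProbabilityMeasure_map (μ.measurable_ergodicComponent hT).aemeasurable,
    μ.ae_ergodic_ergodicComponent hT, fun B hB ↦ ?_⟩
  have hBm : Measurable fun ν : InvariantMeasure T ↦ ν.toMeasure B :=
    (Measure.measurable_coe hB).comp measurable_toMeasure
  rw [lintegral_map hBm (μ.measurable_ergodicComponent hT)]
  calc μ.toMeasure B
      = ∫⁻ x, μ.conditional x B ∂μ.toMeasure := by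
        have h : (μ.toMeasure.trim hm).bind (ProbabilityTheory.condExpKernel μ.toMeasure
            (MeasurableSpace.invariants T)) B = μ.toMeasure B := by
          rw [ProbabilityTheory.condExpKernel_comp_trim]
        rw [Measure.bind_apply hB (ProbabilityTheory.Kernel.aemeasurable _), lintegral_trim hm
          (ProbabilityTheory.measurable_condExpKernel hB)] at h
        exact h.symm
    _ = ∫⁻ x, (μ.ergodicComponent hT x).toMeasure B ∂μ.toMeasure := by
        refine lintegral_congr_ae ?_
        filter_upwards [μ.ae_mem_conditionalDomain hT] with x hx
        rw [μ.toMeasure_ergodicComponent hT hx]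

end InvariantMeasure

/-! ### Subadditive cocycles: the theorems of Fekete and Kingman. -/

/-- A nonnegative subadditive cocycle with at most linear growth. -/
structure IsSubadditiveCocycle {X : Type*} (T : X → X) (f : ℕ → X → ℝ) (C : ℝ) : Prop where
  nonneg : ∀ n x, 0 ≤ f n x
  le_mul : ∀ n x, f n x ≤ n * C
  le_add : ∀ m n x, f (m + n) x ≤ f m x + f n (T^[m] x)

namespace IsSubadditiveCocycle

variable {X : Type*} {T : X → X} {f : ℕ → X → ℝ} {C : ℝ}

section

variable (hf : IsSubadditiveCocycle T f C)
include hf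

theorem const_nonneg (x : X) : 0 ≤ C := by
  have h1 := hf.nonneg 1 x
  have h2 := hf.le_mul 1 x
  simp only [Nat.cast_one, one_mul] at h2
  linarith

theorem inv_mul_le (n : ℕ) (x : X) : (n : ℝ)⁻¹ * f n x ≤ C := by
  rcases Nat.eq_zero_or_pos n with rfl | hn
  · simpa using hf.const_nonneg x
  · rw [inv_mul_le_iff₀ (by exact_mod_cast hn)]; exact hf.le_mul n x

theorem inv_mul_nonneg (n : ℕ) (x : X) : 0 ≤ (n : ℝ)⁻¹ * f n x :=
  mul_nonneg (by positivity) (hf.nonneg n x)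

/-- The orbit is cut into blocks of length $m$ from each of the $m$ possible offsets; together the
blocks use each term of the Birkhoff sum of $f_m$ once. The last, incomplete blocks cost at most
$mC$ each. -/
theorem sum_le_birkhoffSum {m : ℕ} (hm : 0 < m) (n : ℕ) :
    ∀ x, ∑ j ∈ Finset.range m, f n (T^[j] x) ≤ birkhoffSum T (f m) n x + m * (m * C) := by
  induction n using Nat.strong_induction_on with
  | _ n ih =>
    intro x
    by_cases hnm : n < m
    · have h1 : ∑ j ∈ Finset.range m, f n (T^[j] x) ≤ ∑ j ∈ Finset.range m, (m * C) :=
        Finset.sum_le_sum fun j _ ↦ (hf.le_mul n _).trans <| by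
          have := hf.const_nonneg x; gcongr
      have h2 : 0 ≤ birkhoffSum T (f m) n x := Finset.sum_nonneg fun j _ ↦ hf.nonneg m _
      simp only [Finset.sum_const, Finset.card_range, nsmul_eq_mul] at h1
      linarith
    · obtain ⟨k, rfl⟩ := Nat.exists_eq_add_of_le (not_lt.1 hnm)
      have h1 : ∑ j ∈ Finset.range m, f (m + k) (T^[j] x) ≤
          ∑ j ∈ Finset.range m, (f m (T^[j] x) + f k (T^[j] (T^[m] x))) :=
        Finset.sum_le_sum fun j _ ↦ by
          have := hf.le_add m k (T^[j] x)
          rwa [← Function.iterate_add_apply, add_comm m j, Function.iterate_add_apply] at this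
      rw [Finset.sum_add_distrib] at h1
      have h2 := ih k (by lia) (T^[m] x)
      rw [birkhoffSum_add]
      change _ ≤ ∑ j ∈ Finset.range m, f m (T^[j] x) + _ + _
      linarith

/-- Discarding the first $j$ and the last $m-j$ steps costs at most $mC$ for each offset $j$, whence
the factor 2. -/
theorem mul_le_birkhoffSum {m : ℕ} (hm : 0 < m) (n : ℕ) (x : X) :
    m * f (n + m) x ≤ birkhoffSum T (f m) n x + 2 * (m * (m * C)) := by
  have h1 : ∑ j ∈ Finset.range m, f (n + m) x ≤
      ∑ j ∈ Finset.range m, (f n (T^[j] x) + m * C) := by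
    refine Finset.sum_le_sum fun j hj ↦ ?_
    have hj : j < m := Finset.mem_range.1 hj
    have e : n + m = j + (n + (m - j)) := by lia
    have h1 := hf.le_add j (n + (m - j)) x
    have h2 := hf.le_add n (m - j) (T^[j] x)
    have h3 := hf.le_mul j x
    have h4 := hf.le_mul (m - j) (T^[n] (T^[j] x))
    rw [Nat.cast_sub hj.le] at h4
    rw [e]
    nlinarith
  have h2 := hf.sum_le_birkhoffSum hm n x
  simp only [Finset.sum_add_distrib, Finset.sum_const, Finset.card_range, nsmul_eq_mul] at h1
  linarith

variable [MeasurableSpace X]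

theorem integrable (hm : ∀ n, Measurable (f n)) (μ : Measure X) [IsFiniteMeasure μ] (n : ℕ) :
    Integrable (f n) μ :=
  Integrable.of_bound (hm n).aestronglyMeasurable (n * C) (ae_of_all _ fun x ↦ by
    rw [Real.norm_eq_abs, abs_of_nonneg (hf.nonneg n x)]; exact hf.le_mul n x)

theorem inv_mul_integral_nonneg (μ : Measure X) (n : ℕ) : 0 ≤ (n : ℝ)⁻¹ * ∫ x, f n x ∂μ :=
  mul_nonneg (by positivity) (integral_nonneg (hf.nonneg n))

theorem bddBelow (μ : Measure X) :
    BddBelow (Set.range fun n : ℕ+ ↦ (n : ℝ)⁻¹ * ∫ x, f n x ∂μ) :=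
  ⟨0, by rintro _ ⟨n, rfl⟩; exact hf.inv_mul_integral_nonneg μ n⟩

theorem inv_mul_integral_le (hm : ∀ n, Measurable (f n)) (μ : Measure X) [IsProbabilityMeasure μ]
    (n : ℕ) : (n : ℝ)⁻¹ * ∫ x, f n x ∂μ ≤ C := by
  rw [← integral_const_mul]
  refine (integral_mono ((hf.integrable hm μ n).const_mul _) (integrable_const C)
    (hf.inv_mul_le n)).trans_eq (by simp)

theorem tendsto_inv_mul_integral (hm : ∀ n, Measurable (f n)) {μ : Measure X}
    [IsProbabilityMeasure μ] (hT : MeasurePreserving T μ μ) :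
    Tendsto (fun n : ℕ ↦ (n : ℝ)⁻¹ * ∫ x, f n x ∂μ) atTop
      (𝓝 (⨅ n : ℕ+, (n : ℝ)⁻¹ * ∫ x, f n x ∂μ)) := by
  have hs : Subadditive fun n ↦ ∫ x, f n x ∂μ := fun m n ↦ by
    have hi : Integrable (fun x ↦ f n (T^[m] x)) μ :=
      (hT.iterate m).integrable_comp_of_integrable (hf.integrable hm μ n)
    simp only
    rw [← integral_comp_of_measurePreserving (hT.iterate m) (hm n),
      ← integral_add (hf.integrable hm μ m) hi]
    exact integral_mono (hf.integrable hm μ _) ((hf.integrable hm μ m).add hi) (hf.le_add m n)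
  have hb : BddBelow (Set.range fun n : ℕ ↦ (∫ x, f n x ∂μ) / n) :=
    ⟨0, by rintro _ ⟨n, rfl⟩; exact div_nonneg (integral_nonneg (hf.nonneg n)) (by positivity)⟩
  have h := hs.tendsto_lim hb
  have e : hs.lim = ⨅ n : ℕ+, (n : ℝ)⁻¹ * ∫ x, f n x ∂μ := by
    rw [Subadditive.lim, iInf]
    congr 1
    ext r
    simp only [Set.mem_image, Set.mem_Ici, Set.mem_range]
    constructor
    · rintro ⟨n, hn, rfl⟩
      exact ⟨⟨n, hn⟩, by simp [div_eq_inv_mul]⟩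
    · rintro ⟨n, rfl⟩
      exact ⟨n, n.2, by simp [div_eq_inv_mul]⟩
  rw [← e]
  exact h.congr fun n ↦ by rw [div_eq_inv_mul]

/-- Pick $m$ with $\frac1m\int f_m<r$ and apply Birkhoff's theorem to $f_m$: by
`mul_le_birkhoffSum`, $\frac1nf_n$ is at most $\frac1m$ times its Birkhoff average, up to $O(1/n)$.
-/
theorem ae_eventually_le (hm : ∀ n, Measurable (f n)) {μ : Measure X} [IsProbabilityMeasure μ]
    (hT : Ergodic T μ) : ∀ᵐ x ∂μ, ∀ r, (⨅ n : ℕ+, (n : ℝ)⁻¹ * ∫ x, f n x ∂μ) < r →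
      ∀ᶠ n : ℕ in atTop, (n : ℝ)⁻¹ * f n x < r := by
  have h : ∀ m : ℕ+, ∀ᵐ x ∂μ, Tendsto (fun n ↦ birkhoffAverage ℝ T (f m) n x) atTop
      (𝓝 (∫ y, f m y ∂μ)) := fun m ↦
    hT.ae_tendsto_birkhoffAverage (hm m) (C := m * C) fun x ↦ by
      rw [abs_of_nonneg (hf.nonneg m x)]; exact hf.le_mul m x
  filter_upwards [ae_all_iff.2 h] with x hx r hr
  obtain ⟨m, hmr⟩ := exists_lt_of_ciInf_lt hr
  have hm0 : (0 : ℝ) < m := by exact_mod_cast m.2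
  have hlim : Tendsto (fun n : ℕ ↦ (m : ℝ)⁻¹ * birkhoffAverage ℝ T (f m) n x +
      (2 * (m * C)) / n) atTop (𝓝 ((m : ℝ)⁻¹ * ∫ y, f m y ∂μ + 0)) :=
    ((hx m).const_mul _).add (tendsto_const_nhds.div_atTop tendsto_natCast_atTop_atTop)
  rw [add_zero] at hlim
  have hev := hlim.eventually (gt_mem_nhds hmr)
  refine (eventually_atTop.2 ?_ : ∀ᶠ n : ℕ in atTop, _)
  obtain ⟨N, hN⟩ := eventually_atTop.1 (hev.and (eventually_gt_atTop 0))
  refine ⟨N + m, fun n hn ↦ ?_⟩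
  obtain ⟨k, rfl⟩ : ∃ k, n = k + m := ⟨n - m, by lia⟩
  obtain ⟨h1, hk⟩ := hN k (by lia)
  refine lt_of_le_of_lt ?_ h1
  have hk0 : (0 : ℝ) < k := by exact_mod_cast hk
  have h2 := hf.mul_le_birkhoffSum m.pos k x
  have h3 : f (k + m) x ≤ (m : ℝ)⁻¹ * birkhoffSum T (f m) k x + 2 * (m * C) := by
    rw [← mul_le_mul_iff_right₀ hm0]
    refine h2.trans_eq ?_
    field_simp
  have h5 : 0 ≤ f (k + m) x := hf.nonneg _ _
  calc ((k + m : ℕ) : ℝ)⁻¹ * f (k + m) x ≤ (k : ℝ)⁻¹ * f (k + m) x := by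
        gcongr; simp
    _ ≤ (k : ℝ)⁻¹ * ((m : ℝ)⁻¹ * birkhoffSum T (f m) k x + 2 * (m * C)) := by gcongr
    _ = (m : ℝ)⁻¹ * birkhoffAverage ℝ T (f m) k x + (2 * (m * C)) / k := by
        rw [birkhoffAverage, smul_eq_mul]; field_simp

/-- With $u_n=\frac1nf_n$, the almost everywhere upper bound gives $\int(u_n-L)^+\to0$. As $\int
u_n\ge L$ for $n\ge1$, this forces $u_n\to L$ in $L^1$, so $u_n$ cannot stay below $L-\delta$ on a
set of positive measure. -/
theorem ae_frequently_lt (hm : ∀ n, Measurable (f n)) {μ : Measure X} [IsProbabilityMeasure μ]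
    (hT : Ergodic T μ) : ∀ᵐ x ∂μ, ∀ r, r < (⨅ n : ℕ+, (n : ℝ)⁻¹ * ∫ x, f n x ∂μ) →
      ∃ᶠ n : ℕ in atTop, r < (n : ℝ)⁻¹ * f n x := by
  set L := ⨅ n : ℕ+, (n : ℝ)⁻¹ * ∫ x, f n x ∂μ with hL
  let u : ℕ → X → ℝ := fun n x ↦ (n : ℝ)⁻¹ * f n x
  have hum : ∀ n, Measurable (u n) := fun n ↦ (hm n).const_mul _
  have hui : ∀ n, Integrable (u n) μ := fun n ↦ (hf.integrable hm μ n).const_mul _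
  have huL : ∀ n, Integrable (fun x ↦ u n x - L) μ := fun n ↦ (hui n).sub (integrable_const L)
  have hL0 : 0 ≤ L := Real.iInf_nonneg fun n ↦ hf.inv_mul_integral_nonneg μ n
  have hpos : Tendsto (fun n ↦ ∫ x, max (u n x - L) 0 ∂μ) atTop (𝓝 (∫ _, (0 : ℝ) ∂μ)) := by
    refine tendsto_integral_of_dominated_convergence (fun _ ↦ C)
      (fun n ↦ (((hum n).sub_const L).max measurable_const).aestronglyMeasurable)
      (integrable_const _) (fun n ↦ ae_of_all _ fun x ↦ ?_) ?_
    · rw [Real.norm_eq_abs, abs_of_nonneg (le_max_right _ _)]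
      have : u n x ≤ C := hf.inv_mul_le n x
      exact max_le (by linarith) (hf.const_nonneg x)
    · filter_upwards [hf.ae_eventually_le hm hT] with x hx
      refine tendsto_order.2 ⟨fun a ha ↦ Eventually.of_forall fun n ↦
        ha.trans_le (le_max_right _ _), fun a ha ↦ ?_⟩
      filter_upwards [hx (L + a) (by linarith)] with n hn
      have : u n x < L + a := hn
      exact max_lt (by linarith) ha
  have habs : Tendsto (fun n ↦ ∫ x, |u n x - L| ∂μ) atTop (𝓝 0) := by
    rw [integral_zero] at hpos
    have h2 := hpos.const_mul 2
    rw [mul_zero] at h2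
    refine squeeze_zero' (Eventually.of_forall fun n ↦ integral_nonneg fun x ↦ abs_nonneg _)
      ?_ h2
    filter_upwards [eventually_gt_atTop 0] with n hn
    have hmax : Integrable (fun x ↦ max (u n x - L) 0) μ := (huL n).pos_part
    -- $|t|=2t^+-t$, and the last term has nonpositive contribution to the integral.
    have e : ∀ x, |u n x - L| = 2 * max (u n x - L) 0 - (u n x - L) := fun x ↦ by
      rcases le_total 0 (u n x - L) with h | h
      · rw [abs_of_nonneg h, max_eq_left h]; ring
      · rw [abs_of_nonpos h, max_eq_right h]; ring
    simp only [e]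
    rw [integral_sub (hmax.const_mul 2) (huL n), integral_const_mul,
      integral_sub (hui n) (integrable_const L)]
    have : L ≤ ∫ x, u n x ∂μ := by
      simp only [u]
      rw [integral_const_mul]
      exact ciInf_le (hf.bddBelow μ) ⟨n, hn⟩
    simp only [integral_const, probReal_univ, one_smul]
    linarith
  have hnull : ∀ k N : ℕ, μ {x | ∀ n ≥ N, u n x ≤ L - 1 / ((k : ℝ) + 1)} = 0 := by
    intro k N
    set B := {x | ∀ n ≥ N, u n x ≤ L - 1 / ((k : ℝ) + 1)} with hB
    have hBm : MeasurableSet B := by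
      rw [hB, Set.ofPred_forall]
      refine MeasurableSet.iInter fun n ↦ ?_
      rw [Set.ofPred_forall]
      exact MeasurableSet.iInter fun _ ↦ measurableSet_le (hum n) measurable_const
    have hk : (0 : ℝ) < 1 / ((k : ℝ) + 1) := Nat.one_div_pos_of_nat
    have : μ.real B * (1 / ((k : ℝ) + 1)) ≤ 0 := by
      refine ge_of_tendsto habs ?_
      filter_upwards [eventually_ge_atTop N] with n hn
      calc μ.real B * (1 / ((k : ℝ) + 1)) = ∫ _ in B, (1 / ((k : ℝ) + 1)) ∂μ := by simp
        _ ≤ ∫ x in B, |u n x - L| ∂μ :=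
          setIntegral_mono_on (integrable_const _).integrableOn (huL n).abs.integrableOn hBm
            fun x hx ↦ by
              have := hx n hn
              exact le_trans (by linarith) (neg_le_abs _)
        _ ≤ ∫ x, |u n x - L| ∂μ :=
          setIntegral_le_integral (huL n).abs (ae_of_all _ fun x ↦ abs_nonneg _)
    have h3 : μ.real B = 0 := le_antisymm (by nlinarith) measureReal_nonneg
    exact (measureReal_eq_zero_iff).1 h3
  have hae : ∀ᵐ x ∂μ, ∀ k N : ℕ, ¬ ∀ n ≥ N, u n x ≤ L - 1 / ((k : ℝ) + 1) :=
    ae_all_iff.2 fun k ↦ ae_all_iff.2 fun N ↦ measure_eq_zero_iff_ae_notMem.1 (hnull k N)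
  filter_upwards [hae] with x hx r hr
  obtain ⟨k, hk⟩ := exists_nat_one_div_lt (sub_pos.2 hr)
  refine frequently_atTop.2 fun N ↦ ?_
  have := hx k N
  push Not at this
  obtain ⟨n, hn, h⟩ := this
  exact ⟨n, hn, by change r < u n x; linarith⟩

/-- Kingman's theorem for nonnegative subadditive cocycles of linear growth, in the form of an upper
limit. -/
theorem ae_limsup_eq (hm : ∀ n, Measurable (f n)) {μ : Measure X} [IsProbabilityMeasure μ]
    (hT : Ergodic T μ) : ∀ᵐ x ∂μ, limsup (fun n : ℕ ↦ (n : ℝ)⁻¹ * f n x) atTop =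
      ⨅ n : ℕ+, (n : ℝ)⁻¹ * ∫ x, f n x ∂μ := by
  filter_upwards [hf.ae_eventually_le hm hT, hf.ae_frequently_lt hm hT] with x h1 h2
  have hb : IsBoundedUnder (· ≤ ·) atTop fun n : ℕ ↦ (n : ℝ)⁻¹ * f n x :=
    isBoundedUnder_of ⟨C, fun n ↦ hf.inv_mul_le n x⟩
  have hc : IsCoboundedUnder (· ≤ ·) atTop fun n : ℕ ↦ (n : ℝ)⁻¹ * f n x :=
    (isBoundedUnder_of ⟨0, fun n ↦ hf.inv_mul_nonneg n x⟩ :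
      IsBoundedUnder (· ≥ ·) atTop _).isCoboundedUnder_le
  refine le_antisymm (le_of_forall_gt_imp_ge_of_dense fun r hr ↦ ?_)
    (le_of_forall_lt_imp_le_of_dense fun r hr ↦ ?_)
  · exact limsup_le_of_le hc ((h1 r hr).mono fun n ↦ le_of_lt)
  · exact le_limsup_of_frequently_le ((h2 r hr).mono fun n ↦ le_of_lt) hb

end

end IsSubadditiveCocycle

/-! ### The growth rate as a function of the measure. -/

namespace InvariantMeasure

variable {X : Type*} [TopologicalSpace X] [MeasurableSpace X] [BorelSpace X] [CompactSpace X]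
  {T : X → X} {f : ℕ → X → ℝ} {C : ℝ}

theorem continuous_inv_mul_integral (hc : ∀ n, Continuous (f n)) (n : ℕ) :
    Continuous fun ν : InvariantMeasure T ↦ (n : ℝ)⁻¹ * ∫ x, f n x ∂ν.toMeasure :=
  continuous_const.mul (continuous_integral ⟨f n, hc n⟩)

theorem measurable_iInf_inv_mul_integral (hc : ∀ n, Continuous (f n)) :
    Measurable fun ν : InvariantMeasure T ↦ ⨅ n : ℕ+, (n : ℝ)⁻¹ * ∫ x, f n x ∂ν.toMeasure :=
  Measurable.iInf fun n ↦ (continuous_inv_mul_integral hc n).measurable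

theorem upperSemicontinuous_iInf_inv_mul_integral (hf : IsSubadditiveCocycle T f C)
    (hc : ∀ n, Continuous (f n)) : UpperSemicontinuous fun ν : InvariantMeasure T ↦
      ⨅ n : ℕ+, (n : ℝ)⁻¹ * ∫ x, f n x ∂ν.toMeasure :=
  upperSemicontinuous_ciInf (fun ν ↦ hf.bddBelow ν.toMeasure)
    fun n ↦ (continuous_inv_mul_integral hc n).upperSemicontinuous

theorem integrable_iInf_inv_mul_integral (hf : IsSubadditiveCocycle T f C)
    (hc : ∀ n, Continuous (f n)) (P : Measure (InvariantMeasure T)) [IsFiniteMeasure P] :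
    Integrable (fun ν : InvariantMeasure T ↦ ⨅ n : ℕ+, (n : ℝ)⁻¹ * ∫ x, f n x ∂ν.toMeasure) P :=
  Integrable.of_bound (measurable_iInf_inv_mul_integral hc).aestronglyMeasurable C
    (ae_of_all _ fun ν ↦ by
      rw [Real.norm_eq_abs,
        abs_of_nonneg (Real.iInf_nonneg fun n : ℕ+ ↦ hf.inv_mul_integral_nonneg ν.toMeasure n)]
      exact (ciInf_le (hf.bddBelow ν.toMeasure) 1).trans
        (hf.inv_mul_integral_le (fun n ↦ (hc n).measurable) ν.toMeasure _))

/-- The growth rate of a continuous subadditive cocycle is harmonic. -/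
theorem IsErgodicDecomposition.integral_iInf_inv_mul_integral [HasOuterApproxClosed X]
    (hf : IsSubadditiveCocycle T f C) (hc : ∀ n, Continuous (f n)) {μ : InvariantMeasure T}
    {P : Measure (InvariantMeasure T)} (hP : μ.IsErgodicDecomposition P) :
    ∫ ν, ⨅ n : ℕ+, (n : ℝ)⁻¹ * ∫ x, f n x ∂ν.toMeasure ∂P =
      ⨅ n : ℕ+, (n : ℝ)⁻¹ * ∫ x, f n x ∂μ.toMeasure := by
  have := hP.isProbabilityMeasure
  have hm : ∀ n, Measurable (f n) := fun n ↦ (hc n).measurable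
  refine tendsto_nhds_unique (tendsto_integral_of_dominated_convergence (fun _ ↦ C)
      (F := fun n ν ↦ (n : ℝ)⁻¹ * ∫ x, f n x ∂ν.toMeasure)
      (fun n ↦ (continuous_inv_mul_integral hc n).measurable.aestronglyMeasurable)
      (integrable_const _) (fun n ↦ ae_of_all _ fun ν ↦ ?_) (ae_of_all _ fun ν ↦
        hf.tendsto_inv_mul_integral hm ν.measurePreserving))
    ((hf.tendsto_inv_mul_integral hm μ.measurePreserving).congr fun n ↦ ?_)
  · rw [Real.norm_eq_abs, abs_of_nonneg (hf.inv_mul_integral_nonneg ν.toMeasure n)]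
    exact hf.inv_mul_integral_le hm ν.toMeasure n
  · rw [integral_const_mul]
    exact congrArg _ (hP.integral_integral ⟨f n, hc n⟩).symm

end InvariantMeasure

/-! ### Growth of operator norms and growth of vectors. -/

section Growth

variable {E : Type*} [NormedAddCommGroup E] [NormedSpace ℝ E] {F : ℕ → Type*}
  [∀ n, NormedAddCommGroup (F n)] [∀ n, NormedSpace ℝ (F n)] {A : ∀ n, E →L[ℝ] F n} {K : ℝ}

theorem limsup_inv_mul_le_of_le_add {a b : ℕ → ℝ} {B c ℓ : ℝ} (ha : ∀ n : ℕ, |(n : ℝ)⁻¹ * a n| ≤ B)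
    (hab : ∀ᶠ n in atTop, a n ≤ b n + c)
    (hb : ∀ r > ℓ, ∀ᶠ n : ℕ in atTop, (n : ℝ)⁻¹ * b n < r) :
    limsup (fun n : ℕ ↦ (n : ℝ)⁻¹ * a n) atTop ≤ ℓ := by
  have hco : IsCoboundedUnder (· ≤ ·) atTop fun n : ℕ ↦ (n : ℝ)⁻¹ * a n :=
    (isBoundedUnder_of ⟨-B, fun n ↦ (abs_le.1 (ha n)).1⟩ :
      IsBoundedUnder (· ≥ ·) atTop _).isCoboundedUnder_le
  refine le_of_forall_gt_imp_ge_of_dense fun r hr ↦ limsup_le_of_le hco ?_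
  obtain ⟨s, hs1, hs2⟩ := exists_between hr
  have hc : Tendsto (fun n : ℕ ↦ c / n) atTop (𝓝 0) :=
    tendsto_const_nhds.div_atTop tendsto_natCast_atTop_atTop
  filter_upwards [hab, hb s hs1, hc.eventually (gt_mem_nhds (sub_pos.2 hs2))] with n h1 h2 h3
  have : (n : ℝ)⁻¹ * a n ≤ (n : ℝ)⁻¹ * (b n + c) := by gcongr
  rw [mul_add, ← div_eq_inv_mul c] at this
  linarith

theorem abs_inv_mul_log_norm_apply_le (hub : ∀ (n : ℕ) v, ‖A n v‖ ≤ Real.exp (n * K) * ‖v‖)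
    (hlb : ∀ (n : ℕ) v, ‖v‖ ≤ Real.exp (n * K) * ‖A n v‖) (hK : 0 ≤ K) {v : E} (hv : v ≠ 0) (n : ℕ) :
    |(n : ℝ)⁻¹ * Real.log ‖A n v‖| ≤ K + |Real.log ‖v‖| := by
  have hv0 : 0 < ‖v‖ := norm_pos_iff.2 hv
  have hA0 : 0 < ‖A n v‖ := by
    have := hv0.trans_le (hlb n v)
    exact (pos_iff_pos_of_mul_pos this).1 (Real.exp_pos _)
  have h1 := Real.log_le_log hA0 (hub n v)
  have h2 := Real.log_le_log hv0 (hlb n v)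
  rw [Real.log_mul (Real.exp_ne_zero _) hv0.ne', Real.log_exp] at h1
  rw [Real.log_mul (Real.exp_ne_zero _) hA0.ne', Real.log_exp] at h2
  rcases Nat.eq_zero_or_pos n with rfl | hn
  · simp; positivity
  have hn1 : (1 : ℝ) ≤ n := by exact_mod_cast hn
  rw [abs_mul, abs_of_nonneg (by positivity : (0 : ℝ) ≤ (n : ℝ)⁻¹),
    inv_mul_le_iff₀ (by positivity), abs_le]
  have h3 := le_abs_self (Real.log ‖v‖)
  have h4 := neg_abs_le (Real.log ‖v‖)
  have h5 : |Real.log ‖v‖| ≤ n * |Real.log ‖v‖| := le_mul_of_one_le_left (abs_nonneg _) hn1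
  constructor <;> nlinarith

theorem norm_le_exp (hub : ∀ (n : ℕ) v, ‖A n v‖ ≤ Real.exp (n * K) * ‖v‖) (n : ℕ) :
    ‖A n‖ ≤ Real.exp (n * K) :=
  (A n).opNorm_le_bound (Real.exp_pos _).le (hub n)

variable [Nontrivial E]

theorem exp_neg_le_norm (hlb : ∀ (n : ℕ) v, ‖v‖ ≤ Real.exp (n * K) * ‖A n v‖) (n : ℕ) :
    Real.exp (-(n * K)) ≤ ‖A n‖ := by
  obtain ⟨v, hv⟩ := exists_ne (0 : E)
  have hv0 : 0 < ‖v‖ := norm_pos_iff.2 hv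
  have h1 : ‖v‖ ≤ Real.exp (n * K) * (‖A n‖ * ‖v‖) :=
    (hlb n v).trans (by gcongr; exact (A n).le_opNorm v)
  rw [Real.exp_neg, inv_le_iff_one_le_mul₀' (Real.exp_pos _)]
  nlinarith

theorem abs_log_norm_le (hub : ∀ (n : ℕ) v, ‖A n v‖ ≤ Real.exp (n * K) * ‖v‖)
    (hlb : ∀ (n : ℕ) v, ‖v‖ ≤ Real.exp (n * K) * ‖A n v‖) (n : ℕ) :
    |Real.log ‖A n‖| ≤ n * K := by
  have h1 := exp_neg_le_norm hlb n
  have h0 : 0 < ‖A n‖ := (Real.exp_pos _).trans_le h1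
  have h2 := norm_le_exp hub n
  exact abs_le.2 ⟨(Real.le_log_iff_exp_le h0).2 h1, (Real.log_le_iff_le_exp h0).2 h2⟩

theorem abs_inv_mul_log_norm_le (hub : ∀ (n : ℕ) v, ‖A n v‖ ≤ Real.exp (n * K) * ‖v‖)
    (hlb : ∀ (n : ℕ) v, ‖v‖ ≤ Real.exp (n * K) * ‖A n v‖) (hK : 0 ≤ K) (n : ℕ) :
    |(n : ℝ)⁻¹ * Real.log ‖A n‖| ≤ K := by
  rcases Nat.eq_zero_or_pos n with rfl | hn
  · simpa using hK
  have hn1 : (0 : ℝ) < n := by exact_mod_cast hn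
  rw [abs_mul, abs_of_nonneg (by positivity : (0 : ℝ) ≤ (n : ℝ)⁻¹), inv_mul_le_iff₀ hn1]
  exact abs_log_norm_le hub hlb n

/-- The exponential growth rate of the operator norms is the largest growth rate of a vector. -/
theorem isGreatest_limsup_log_norm [FiniteDimensional ℝ E]
    (hub : ∀ (n : ℕ) v, ‖A n v‖ ≤ Real.exp (n * K) * ‖v‖)
    (hlb : ∀ (n : ℕ) v, ‖v‖ ≤ Real.exp (n * K) * ‖A n v‖) (hK : 0 ≤ K) :
    IsGreatest {χ : ℝ | ∃ v : E, v ≠ 0 ∧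
        limsup (fun n : ℕ ↦ (n : ℝ)⁻¹ * Real.log ‖A n v‖) atTop = χ}
      (limsup (fun n : ℕ ↦ (n : ℝ)⁻¹ * Real.log ‖A n‖) atTop) := by
  set ℓ := limsup (fun n : ℕ ↦ (n : ℝ)⁻¹ * Real.log ‖A n‖) atTop with hℓ
  have hAb := abs_inv_mul_log_norm_le hub hlb hK
  have hA0 : ∀ n, 0 < ‖A n‖ := fun n ↦ (Real.exp_pos _).trans_le (exp_neg_le_norm hlb n)
  have hAv0 : ∀ n v, v ≠ 0 → 0 < ‖A n v‖ := fun n v hv ↦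
    (pos_iff_pos_of_mul_pos ((norm_pos_iff.2 hv).trans_le (hlb n v))).1 (Real.exp_pos _)
  have hup : ∀ v : E, v ≠ 0 → limsup (fun n : ℕ ↦ (n : ℝ)⁻¹ * Real.log ‖A n v‖) atTop ≤ ℓ := by
    intro v hv
    refine limsup_inv_mul_le_of_le_add (b := fun n ↦ Real.log ‖A n‖) (c := Real.log ‖v‖)
      (abs_inv_mul_log_norm_apply_le hub hlb hK hv) (Eventually.of_forall fun n ↦ ?_)
      fun r hr ↦ eventually_lt_of_limsup_lt hr
        (isBoundedUnder_of ⟨K, fun n ↦ (abs_le.1 (hAb n)).2⟩)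
    rw [← Real.log_mul (hA0 n).ne' (norm_pos_iff.2 hv).ne']
    exact Real.log_le_log (hAv0 n v hv) ((A n).le_opNorm v)
  refine ⟨?_, ?_⟩
  swap
  · rintro _ ⟨v, hv, rfl⟩
    exact hup v hv
  let b := Module.finBasis ℝ E
  suffices ∃ i, ℓ ≤ limsup (fun n : ℕ ↦ (n : ℝ)⁻¹ * Real.log ‖A n (b i)‖) atTop by
    obtain ⟨i, hi⟩ := this
    exact ⟨b i, b.ne_zero i, le_antisymm (hup _ (b.ne_zero i)) hi⟩
  -- If all basis vectors grew at rates below $\ell$, one $r<\ell$ would bound these finitely many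
  -- rates, hence that of the operator norm.
  by_contra! hlt
  obtain ⟨r, hr, hrℓ⟩ : ∃ r, (∀ i, limsup (fun n : ℕ ↦ (n : ℝ)⁻¹ * Real.log ‖A n (b i)‖) atTop < r)
      ∧ r < ℓ := by
    have h1 : ∀ᶠ r in 𝓝[<] ℓ, ∀ i,
        limsup (fun n : ℕ ↦ (n : ℝ)⁻¹ * Real.log ‖A n (b i)‖) atTop < r :=
      eventually_all.2 fun i ↦ mem_of_superset (Ioo_mem_nhdsLT (hlt i)) fun r hr ↦ hr.1
    exact (h1.and self_mem_nhdsWithin).exists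
  have hev : ∀ᶠ n : ℕ in atTop, ∀ i, (n : ℝ)⁻¹ * Real.log ‖A n (b i)‖ < r :=
    eventually_all.2 fun i ↦ eventually_lt_of_limsup_lt (hr i) (isBoundedUnder_of
      ⟨_, fun n ↦ (abs_le.1 (abs_inv_mul_log_norm_apply_le hub hlb hK (b.ne_zero i) n)).2⟩)
  -- Compares the operator norm with the values on the basis; the maximum with 1 makes its logarithm
  -- usable.
  set C := max (Fintype.card (Fin (Module.finrank ℝ E)) • ‖b.equivFunL.toContinuousLinearMap‖) 1
    with hC
  have hC0 : 0 < C := lt_max_of_lt_right one_pos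
  refine absurd (limsup_inv_mul_le_of_le_add (ℓ := r) (b := fun n ↦ n * r) (c := Real.log C) hAb ?_
    fun s hs ↦ ?_) (not_le.2 hrℓ)
  · filter_upwards [hev, eventually_gt_atTop 0] with n hn hn0
    have hn0' : (0 : ℝ) < n := by exact_mod_cast hn0
    have h1 : ∀ i, ‖A n (b i)‖ ≤ Real.exp (n * r) := fun i ↦ by
      rw [← Real.log_le_iff_le_exp (hAv0 n _ (b.ne_zero i)), ← inv_mul_le_iff₀ hn0']
      exact (hn i).le
    have h2 : ‖A n‖ ≤ C * Real.exp (n * r) := by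
      refine (b.opNorm_le (Real.exp_pos _).le h1).trans ?_
      gcongr
      exact le_max_left _ _
    have h3 := Real.log_le_log (hA0 n) h2
    rw [Real.log_mul hC0.ne' (Real.exp_ne_zero _), Real.log_exp] at h3
    linarith
  · filter_upwards [eventually_gt_atTop 0] with n hn0
    have hn0' : (0 : ℝ) < n := by exact_mod_cast hn0
    rw [inv_mul_cancel_left₀ hn0'.ne']
    exact hs

end Growth

/-! ### Continuity of the norm of the derivative, and uniform expansion bounds. -/

/-- The ratio $\|Av\|/\|v\|$ is scale invariant, so the supremum may be taken over the sphere of a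
model space `G`. In a trivialization this compact set does not depend on the base point. -/
theorem ContinuousLinearMap.norm_eq_sSup_image_sphere {E F G : Type*} [NormedAddCommGroup E]
    [NormedSpace ℝ E] [NormedAddCommGroup F] [NormedSpace ℝ F] [NormedAddCommGroup G]
    [NormedSpace ℝ G] [Nontrivial G] (A : E →L[ℝ] F) (e : G ≃L[ℝ] E) :
    ‖A‖ = sSup ((fun w : Metric.sphere (0 : G) 1 ↦ ‖A (e w)‖ / ‖e w‖) '' Set.univ) := by
  rw [Set.image_univ]
  have hle : ∀ w : Metric.sphere (0 : G) 1, ‖A (e w)‖ / ‖e w‖ ≤ ‖A‖ := fun w ↦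
    A.ratio_le_opNorm (e w)
  have hb : BddAbove (Set.range fun w : Metric.sphere (0 : G) 1 ↦ ‖A (e w)‖ / ‖e w‖) :=
    ⟨‖A‖, by rintro _ ⟨w, rfl⟩; exact hle w⟩
  obtain ⟨w₀, hw₀⟩ := NormedSpace.sphere_nonempty (x := (0 : G)).2 zero_le_one
  refine le_antisymm (A.opNorm_le_bound ?_ fun v ↦ ?_) ?_
  · exact le_trans (by positivity) (le_csSup hb ⟨⟨w₀, hw₀⟩, rfl⟩)
  · rcases eq_or_ne v 0 with rfl | hv
    · simp
    set g := e.symm v with hg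
    have hg0 : g ≠ 0 := by simpa [hg] using hv
    have hgn : ‖g‖ ≠ 0 := norm_ne_zero_iff.2 hg0
    have hv' : v = ‖g‖ • e (‖g‖⁻¹ • g) := by
      rw [map_smul, smul_inv_smul₀ hgn, hg, e.apply_symm_apply]
    have hmem : ‖g‖⁻¹ • g ∈ Metric.sphere (0 : G) 1 := by
      simp [norm_smul, hgn]
    have h := le_csSup hb ⟨⟨_, hmem⟩, rfl⟩
    have hpos : 0 < ‖e (‖g‖⁻¹ • g)‖ := by
      rw [norm_pos_iff]
      simpa [hgn] using hg0
    rw [div_le_iff₀ hpos] at h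
    calc ‖A v‖ = ‖g‖ * ‖A (e (‖g‖⁻¹ • g))‖ := by
          conv_lhs => rw [hv']
          rw [map_smul, norm_smul, norm_norm]
      _ ≤ ‖g‖ * (sSup (Set.range fun w : Metric.sphere (0 : G) 1 ↦ ‖A (e w)‖ / ‖e w‖) *
            ‖e (‖g‖⁻¹ • g)‖) := by gcongr
      _ = sSup (Set.range fun w : Metric.sphere (0 : G) 1 ↦ ‖A (e w)‖ / ‖e w‖) * ‖v‖ := by
          conv_rhs => rw [hv']
          rw [norm_smul, norm_norm]; ring
  · exact csSup_le ⟨_, ⟨⟨w₀, hw₀⟩, rfl⟩⟩ (by rintro _ ⟨w, rfl⟩; exact hle w)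

theorem continuous_norm_totalSpace {B : Type*} [TopologicalSpace B] {F : Type*}
    [NormedAddCommGroup F] [NormedSpace ℝ F] {E : B → Type*} [TopologicalSpace (TotalSpace F E)]
    [∀ x, NormedAddCommGroup (E x)] [∀ x, InnerProductSpace ℝ (E x)] [FiberBundle F E]
    [VectorBundle ℝ F E] [IsContinuousRiemannianBundle F E] :
    Continuous fun p : TotalSpace F E ↦ ‖p.2‖ := by
  have h : Continuous fun p : TotalSpace F E ↦ inner ℝ p.2 p.2 :=
    Continuous.inner_bundle (F := F) (E := E) (b := fun p : TotalSpace F E ↦ p.1)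
      (v := fun p ↦ p.2) (w := fun p ↦ p.2) continuous_id continuous_id
  exact (Real.continuous_sqrt.comp h).congr fun p ↦ by
    simp [Real.sqrt_sq]

section Manifold

theorem ContMDiff.iterate_self {d : ℕ} {M : Type*} [TopologicalSpace M]
    [ChartedSpace (EuclideanSpace ℝ (Fin d)) M] {f : M → M} (hf : ContMDiff (𝓡 d) (𝓡 d) 1 f) (n : ℕ) :
    ContMDiff (𝓡 d) (𝓡 d) 1 f^[n] := by
  induction n with
  | zero => exact contMDiff_id
  | succ n ih => exact ih.comp hf

variable {d : ℕ} {M : Type*} [TopologicalSpace M]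
  [ChartedSpace (EuclideanSpace ℝ (Fin d)) M] [IsManifold (𝓡 d) 1 M]
  [RiemannianBundle (fun x : M ↦ TangentSpace (𝓡 d) x)]

omit [IsManifold (𝓡 d) 1 M] in
theorem norm_mfderiv_comp_apply {f g : M → M} {x : M} (hg : MDifferentiableAt (𝓡 d) (𝓡 d) g (f x))
    (hf : MDifferentiableAt (𝓡 d) (𝓡 d) f x) (v : TangentSpace (𝓡 d) x) :
    ‖mfderiv (𝓡 d) (𝓡 d) (g ∘ f) x v‖ =
      ‖mfderiv (𝓡 d) (𝓡 d) g (f x) (mfderiv (𝓡 d) (𝓡 d) f x v)‖ := by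
  rw [mfderiv_comp x hg hf]
  rfl

omit [IsManifold (𝓡 d) 1 M] in
theorem norm_mfderiv_comp_le {f g : M → M} {x : M} (hg : MDifferentiableAt (𝓡 d) (𝓡 d) g (f x))
    (hf : MDifferentiableAt (𝓡 d) (𝓡 d) f x) :
    ‖mfderiv (𝓡 d) (𝓡 d) (g ∘ f) x‖ ≤
      ‖mfderiv (𝓡 d) (𝓡 d) g (f x)‖ * ‖mfderiv (𝓡 d) (𝓡 d) f x‖ := by
  rw [mfderiv_comp x hg hf]
  exact ContinuousLinearMap.opNorm_comp_le _ _

variable [IsContinuousRiemannianBundle (EuclideanSpace ℝ (Fin d))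
      (fun x : M ↦ TangentSpace (𝓡 d) x)]

/-- In a trivialization the operator norm is the supremum, over the fixed compact unit sphere, of a
jointly continuous ratio. -/
theorem continuous_norm_mfderiv (hd : 1 ≤ d) {f : M → M} (hf : ContMDiff (𝓡 d) (𝓡 d) 1 f) :
    Continuous fun x ↦ ‖mfderiv (𝓡 d) (𝓡 d) f x‖ := by
  have : Nonempty (Fin d) := ⟨⟨0, hd⟩⟩
  have : Nontrivial (EuclideanSpace ℝ (Fin d)) := inferInstance
  let g : TangentBundle (𝓡 d) M → ℝ := fun p ↦ ‖mfderiv (𝓡 d) (𝓡 d) f p.1 p.2‖ / ‖p.2‖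
  have hN : Continuous fun p : TangentBundle (𝓡 d) M ↦ ‖p.2‖ := continuous_norm_totalSpace
  have hD : Continuous fun p : TangentBundle (𝓡 d) M ↦ ‖mfderiv (𝓡 d) (𝓡 d) f p.1 p.2‖ :=
    hN.comp (hf.continuous_tangentMap le_rfl)
  rw [continuous_iff_continuousAt]
  intro x₀
  let e := trivializationAt (EuclideanSpace ℝ (Fin d)) (fun x : M ↦ TangentSpace (𝓡 d) x) x₀
  have hx₀ : x₀ ∈ e.baseSet := FiberBundle.mem_baseSet_trivializationAt' x₀
  suffices h : ContinuousOn (fun x ↦ ‖mfderiv (𝓡 d) (𝓡 d) f x‖) e.baseSet from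
    h.continuousAt (e.open_baseSet.mem_nhds hx₀)
  rw [continuousOn_iff_continuous_domRestrict]
  let s : e.baseSet × Metric.sphere (0 : EuclideanSpace ℝ (Fin d)) 1 → TangentBundle (𝓡 d) M :=
    fun z ↦ ⟨z.1, e.symm z.1 z.2⟩
  have hs : Continuous s := by
    refine e.continuousOn_symm.comp_continuous (f := fun z :
      e.baseSet × Metric.sphere (0 : EuclideanSpace ℝ (Fin d)) 1 ↦
        ((z.1 : M), (z.2 : EuclideanSpace ℝ (Fin d)))) (by fun_prop) fun z ↦ ⟨z.1.2, trivial⟩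
  have hs0 : ∀ z, ‖(s z).2‖ ≠ 0 := fun z ↦ by
    rw [norm_ne_zero_iff]
    change e.symm z.1 z.2 ≠ 0
    rw [← e.continuousLinearEquivAt_symm_apply ℝ _ z.1.2]
    exact fun h ↦ ne_zero_of_mem_unit_sphere z.2
      ((e.continuousLinearEquivAt ℝ _ z.1.2).symm.map_eq_zero_iff.1 h)
  have hq : Continuous fun z ↦ g (s z) := (hD.comp hs).div (hN.comp hs) hs0
  have := IsCompact.continuous_sSup (f := fun (x : e.baseSet) w ↦ g (s (x, w))) isCompact_univ hq
  refine this.congr fun x ↦ ?_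
  have h := ContinuousLinearMap.norm_eq_sSup_image_sphere (mfderiv (𝓡 d) (𝓡 d) f x)
    (e.continuousLinearEquivAt ℝ x x.2).symm
  rw [Set.domRestrict_apply, h]
  simp only [Trivialization.continuousLinearEquivAt_symm_apply]
  rfl

variable [CompactSpace M]

theorem exists_norm_mfderiv_iterate_le (hd : 1 ≤ d) (T : M ≃ₘ^1⟮𝓡 d, 𝓡 d⟯ M) :
    ∃ K : ℝ, 0 ≤ K ∧ ∀ (n : ℕ) (x : M) (v : TangentSpace (𝓡 d) x),
      ‖mfderiv (𝓡 d) (𝓡 d) T^[n] x v‖ ≤ Real.exp (n * K) * ‖v‖ ∧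
      ‖v‖ ≤ Real.exp (n * K) * ‖mfderiv (𝓡 d) (𝓡 d) T^[n] x v‖ := by
  have hc : ∀ f : M → M, ContMDiff (𝓡 d) (𝓡 d) 1 f →
      ∃ C, ∀ x, ‖mfderiv (𝓡 d) (𝓡 d) f x‖ ≤ C := fun f hf ↦ by
    obtain ⟨C, hC⟩ := isCompact_univ.exists_bound_of_continuousOn
      (continuous_norm_mfderiv hd hf).continuousOn
    exact ⟨C, fun x ↦ (le_abs_self _).trans (hC x trivial)⟩
  obtain ⟨C₁, hC₁⟩ := hc T T.contMDiff
  obtain ⟨C₂, hC₂⟩ := hc T.symm T.symm.contMDiff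
  -- The bound on $D(T^{-1})$ gives the lower estimate for $DT$; the 1 ensures $K=\log C\ge0$.
  set C := max (max C₁ C₂) 1 with hC
  have hC0 : 0 < C := lt_max_of_lt_right one_pos
  have hdT : ∀ x, MDifferentiableAt (𝓡 d) (𝓡 d) T x := T.contMDiff.mdifferentiable one_ne_zero
  have hdS : ∀ x, MDifferentiableAt (𝓡 d) (𝓡 d) T.symm x :=
    T.symm.contMDiff.mdifferentiable one_ne_zero
  have hexp : ∀ n : ℕ, Real.exp (n * Real.log C) = C ^ n := fun n ↦ by
    rw [mul_comm, Real.exp_mul, Real.exp_log hC0, Real.rpow_natCast]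
  have h1 : ∀ y (w : TangentSpace (𝓡 d) y), ‖mfderiv (𝓡 d) (𝓡 d) T y w‖ ≤ C * ‖w‖ := fun y w ↦ by
    refine (ContinuousLinearMap.le_opNorm _ w).trans ?_
    gcongr
    exact (hC₁ y).trans ((le_max_left _ _).trans (le_max_left _ _))
  have h2 : ∀ y (w : TangentSpace (𝓡 d) y), ‖w‖ ≤ C * ‖mfderiv (𝓡 d) (𝓡 d) T y w‖ := fun y w ↦ by
    have hcomp : (T.symm ∘ T : M → M) = id := funext fun z ↦ T.symm_apply_apply z
    have e : ‖mfderiv (𝓡 d) (𝓡 d) (T.symm ∘ T : M → M) y w‖ = ‖w‖ := by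
      rw [hcomp, mfderiv_id]; rfl
    rw [← e, norm_mfderiv_comp_apply (hdS _) (hdT _)]
    refine (ContinuousLinearMap.le_opNorm _ _).trans ?_
    gcongr
    exact (hC₂ _).trans ((le_max_right _ _).trans (le_max_left _ _))
  refine ⟨Real.log C, Real.log_nonneg (le_max_right _ _), fun n ↦ ?_⟩
  simp only [hexp]
  induction n with
  | zero =>
    intro x v
    have e : ‖mfderiv (𝓡 d) (𝓡 d) T^[0] x v‖ = ‖v‖ := by
      rw [Function.iterate_zero, mfderiv_id]; rfl
    rw [e]
    simp
  | succ n ih =>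
    intro x v
    have hn := (T.contMDiff.iterate_self n).mdifferentiable one_ne_zero x
    rw [Function.iterate_succ', norm_mfderiv_comp_apply (hdT _) hn, pow_succ]
    obtain ⟨i1, i2⟩ := ih x v
    have j1 := h1 _ (mfderiv (𝓡 d) (𝓡 d) T^[n] x v)
    have j2 := h2 _ (mfderiv (𝓡 d) (𝓡 d) T^[n] x v)
    constructor
    · calc _ ≤ C * ‖mfderiv (𝓡 d) (𝓡 d) T^[n] x v‖ := j1
        _ ≤ C * (C ^ n * ‖v‖) := by gcongr
        _ = _ := by ring
    · calc ‖v‖ ≤ C ^ n * ‖mfderiv (𝓡 d) (𝓡 d) T^[n] x v‖ := i2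
        _ ≤ C ^ n * (C * ‖mfderiv (𝓡 d) (𝓡 d) T (T^[n] x) (mfderiv (𝓡 d) (𝓡 d) T^[n] x v)‖) := by
            gcongr
        _ = _ := by ring

end Manifold

/-! ### Lyapunov exponents of the diffeomorphism. -/

section Exponents

variable {d : ℕ} {M : Type*} [TopologicalSpace M]
  [ChartedSpace (EuclideanSpace ℝ (Fin d)) M]

theorem nontrivial_tangentSpace (hd : 1 ≤ d) (x : M) : Nontrivial (TangentSpace (𝓡 d) x) := by
  have : Nonempty (Fin d) := ⟨⟨0, hd⟩⟩
  exact inferInstanceAs (Nontrivial (EuclideanSpace ℝ (Fin d)))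

theorem finiteDimensional_tangentSpace (x : M) :
    FiniteDimensional ℝ (TangentSpace (𝓡 d) x) :=
  inferInstanceAs (FiniteDimensional ℝ (EuclideanSpace ℝ (Fin d)))

variable [RiemannianBundle (fun x : M ↦ TangentSpace (𝓡 d) x)] (T : M ≃ₘ^1⟮𝓡 d, 𝓡 d⟯ M)

/-- `K` bounds the exponential growth rates of `D T^n` and of its inverse. -/
def IsExpansionBound (K : ℝ) : Prop :=
  ∀ (n : ℕ) (x : M) (v : TangentSpace (𝓡 d) x),
    ‖mfderiv (𝓡 d) (𝓡 d) T^[n] x v‖ ≤ Real.exp (n * K) * ‖v‖ ∧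
    ‖v‖ ≤ Real.exp (n * K) * ‖mfderiv (𝓡 d) (𝓡 d) T^[n] x v‖

variable {T} {K : ℝ}

theorem isLargestLyapunovExponent_largestLyapunovExponent [MeasurableSpace M] {ν : Measure M} {a : ℝ}
    (ha : IsLargestLyapunovExponent (d := d) T ν a) :
    IsLargestLyapunovExponent (d := d) T ν (largestLyapunovExponent (d := d) T ν) := by
  have h : ∃ c : ℝ, IsLargestLyapunovExponent (d := d) T ν c := ⟨a, ha⟩
  rw [largestLyapunovExponent, dif_pos h]
  exact h.choose_spec

theorem norm_mfderiv_iterate_add_le (m n : ℕ) (x : M) :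
    ‖mfderiv (𝓡 d) (𝓡 d) T^[m + n] x‖ ≤
      ‖mfderiv (𝓡 d) (𝓡 d) T^[m] x‖ * ‖mfderiv (𝓡 d) (𝓡 d) T^[n] (T^[m] x)‖ := by
  rw [add_comm, Function.iterate_add, mul_comm]
  exact norm_mfderiv_comp_le ((T.contMDiff.iterate_self n).mdifferentiable one_ne_zero _)
    ((T.contMDiff.iterate_self m).mdifferentiable one_ne_zero _)

namespace IsExpansionBound

variable (hK : IsExpansionBound T K)
include hK

theorem norm_pos (hd : 1 ≤ d) (n : ℕ) (x : M) : 0 < ‖mfderiv (𝓡 d) (𝓡 d) T^[n] x‖ := by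
  have := nontrivial_tangentSpace hd x
  exact (Real.exp_pos _).trans_le (exp_neg_le_norm (E := TangentSpace (𝓡 d) x)
    (F := fun n ↦ TangentSpace (𝓡 d) (T^[n] x))
    (A := fun n ↦ mfderiv (𝓡 d) (𝓡 d) T^[n] x) (fun n v ↦ (hK n x v).2) n)

theorem abs_log_norm_le (hd : 1 ≤ d) (n : ℕ) (x : M) :
    |Real.log ‖mfderiv (𝓡 d) (𝓡 d) T^[n] x‖| ≤ n * K := by
  have := nontrivial_tangentSpace hd x
  exact _root_.abs_log_norm_le (E := TangentSpace (𝓡 d) x)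
    (F := fun n ↦ TangentSpace (𝓡 d) (T^[n] x))
    (A := fun n ↦ mfderiv (𝓡 d) (𝓡 d) T^[n] x) (fun n v ↦ (hK n x v).1)
    (fun n v ↦ (hK n x v).2) n

theorem isGreatest_lyapunovExponent (hd : 1 ≤ d) (hK0 : 0 ≤ K) (x : M) :
    IsGreatest {χ : ℝ | ∃ v : TangentSpace (𝓡 d) x, v ≠ 0 ∧ lyapunovExponent T x v = χ}
      (limsup (fun n : ℕ ↦ (n : ℝ)⁻¹ * Real.log ‖mfderiv (𝓡 d) (𝓡 d) T^[n] x‖) atTop) := by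
  have := nontrivial_tangentSpace hd x
  have := finiteDimensional_tangentSpace (d := d) x
  exact isGreatest_limsup_log_norm (E := TangentSpace (𝓡 d) x)
    (F := fun n ↦ TangentSpace (𝓡 d) (T^[n] x))
    (A := fun n ↦ mfderiv (𝓡 d) (𝓡 d) T^[n] x) (fun n v ↦ (hK n x v).1)
    (fun n v ↦ (hK n x v).2) hK0

theorem isSubadditiveCocycle_posLog (hd : 1 ≤ d) :
    IsSubadditiveCocycle T (fun n x ↦ Real.posLog ‖mfderiv (𝓡 d) (𝓡 d) T^[n] x‖) K where
  nonneg _ _ := Real.posLog_nonneg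
  le_mul n x := by
    have h := hK.abs_log_norm_le hd n x
    exact max_le ((abs_nonneg _).trans h) ((le_abs_self _).trans h)
  le_add m n x := by
    refine le_trans (Real.posLog_le_posLog ?_ (norm_mfderiv_iterate_add_le m n x)) Real.posLog_mul
    exact norm_nonneg (mfderiv (𝓡 d) (𝓡 d) T^[m + n] x)

/-- The shift by $nK$ makes $\log\|D_xT^n\|\ge-nK$ nonnegative without losing subadditivity, so that
Kingman's theorem also reaches negative exponents. -/
theorem isSubadditiveCocycle_log (hd : 1 ≤ d) :
    IsSubadditiveCocycle T
      (fun n x ↦ Real.log ‖mfderiv (𝓡 d) (𝓡 d) T^[n] x‖ + n * K) (2 * K) where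
  nonneg n x := by linarith [(abs_le.1 (hK.abs_log_norm_le hd n x)).1]
  le_mul n x := by linarith [(abs_le.1 (hK.abs_log_norm_le hd n x)).2]
  le_add m n x := by
    have h := Real.log_le_log (hK.norm_pos hd (m + n) x) (norm_mfderiv_iterate_add_le m n x)
    rw [Real.log_mul (hK.norm_pos hd m x).ne' (hK.norm_pos hd n _).ne'] at h
    push_cast
    linarith

theorem isBoundedUnder (hd : 1 ≤ d) (hK0 : 0 ≤ K) (x : M) :
    (IsBoundedUnder (· ≤ ·) atTop fun n : ℕ ↦
        (n : ℝ)⁻¹ * Real.log ‖mfderiv (𝓡 d) (𝓡 d) T^[n] x‖) ∧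
      IsCoboundedUnder (· ≤ ·) atTop fun n : ℕ ↦
        (n : ℝ)⁻¹ * Real.log ‖mfderiv (𝓡 d) (𝓡 d) T^[n] x‖ := by
  have h : ∀ n : ℕ, |(n : ℝ)⁻¹ * Real.log ‖mfderiv (𝓡 d) (𝓡 d) T^[n] x‖| ≤ K := fun n ↦ by
    rcases Nat.eq_zero_or_pos n with rfl | hn
    · simpa using hK0
    rw [abs_mul, abs_of_nonneg (by positivity : (0 : ℝ) ≤ (n : ℝ)⁻¹),
      inv_mul_le_iff₀ (by exact_mod_cast hn)]
    exact hK.abs_log_norm_le hd n x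
  exact ⟨isBoundedUnder_of ⟨K, fun n ↦ (abs_le.1 (h n)).2⟩,
    (isBoundedUnder_of ⟨-K, fun n ↦ (abs_le.1 (h n)).1⟩ :
      IsBoundedUnder (· ≥ ·) atTop _).isCoboundedUnder_le⟩

/-- Truncation at 0 is monotone and continuous, hence commutes with the upper limit. -/
theorem limsup_posLog (hd : 1 ≤ d) (hK0 : 0 ≤ K) (x : M) :
    limsup (fun n : ℕ ↦ (n : ℝ)⁻¹ * Real.posLog ‖mfderiv (𝓡 d) (𝓡 d) T^[n] x‖) atTop =
      max (limsup (fun n : ℕ ↦ (n : ℝ)⁻¹ *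
        Real.log ‖mfderiv (𝓡 d) (𝓡 d) T^[n] x‖) atTop) 0 := by
  obtain ⟨h1, h2⟩ := hK.isBoundedUnder hd hK0 x
  have hmono : Monotone fun t : ℝ ↦ max t 0 := fun a b hab ↦ max_le_max_right 0 hab
  refine Eq.trans ?_ (hmono.map_limsup_of_continuousAt _
    (continuous_id.max continuous_const).continuousAt h1 h2).symm
  congr 1
  funext n
  simp only [Real.posLog, Function.comp_apply]
  rw [mul_max_of_nonneg _ _ (by positivity), mul_zero, max_comm]

theorem limsup_log_add (hd : 1 ≤ d) (hK0 : 0 ≤ K) (x : M) :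
    limsup (fun n : ℕ ↦ (n : ℝ)⁻¹ *
        (Real.log ‖mfderiv (𝓡 d) (𝓡 d) T^[n] x‖ + n * K)) atTop =
      limsup (fun n : ℕ ↦ (n : ℝ)⁻¹ * Real.log ‖mfderiv (𝓡 d) (𝓡 d) T^[n] x‖) atTop + K := by
  obtain ⟨h1, h2⟩ := hK.isBoundedUnder hd hK0 x
  have hmono : Monotone fun t : ℝ ↦ t + K := fun a b hab ↦ add_le_add_left hab K
  refine Eq.trans ?_ (hmono.map_limsup_of_continuousAt _
    (continuous_id.add continuous_const).continuousAt h1 h2).symm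
  refine limsup_congr ?_
  -- At $n=0$ the inverse is 0 by convention and the two sequences may differ.
  filter_upwards [eventually_gt_atTop 0] with n hn
  have : (n : ℝ) ≠ 0 := by exact_mod_cast hn.ne'
  simp only [Function.comp_apply]
  rw [mul_add, inv_mul_cancel_left₀ this]

end IsExpansionBound

variable [IsManifold (𝓡 d) 1 M] [IsContinuousRiemannianBundle (EuclideanSpace ℝ (Fin d))
    (fun x : M ↦ TangentSpace (𝓡 d) x)]

theorem continuous_posLog_norm_mfderiv (hd : 1 ≤ d) (n : ℕ) :
    Continuous fun x ↦ Real.posLog ‖mfderiv (𝓡 d) (𝓡 d) T^[n] x‖ :=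
  Real.continuous_posLog.comp (continuous_norm_mfderiv hd (T.contMDiff.iterate_self n))

variable [CompactSpace M] [MeasurableSpace M] [BorelSpace M]

theorem Ergodic.isLargestLyapunovExponent (hd : 1 ≤ d) {ν : Measure M} [IsProbabilityMeasure ν]
    (hν : Ergodic T ν) :
    IsLargestLyapunovExponent (d := d) T ν (largestLyapunovExponent (d := d) T ν) := by
  obtain ⟨K, hK0, hK⟩ := exists_norm_mfderiv_iterate_le hd T
  replace hK : IsExpansionBound T K := hK
  have hm : ∀ n : ℕ, Measurable fun x ↦ Real.log ‖mfderiv (𝓡 d) (𝓡 d) T^[n] x‖ + n * K :=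
    fun n ↦ (continuous_norm_mfderiv hd
      (T.contMDiff.iterate_self n)).measurable.log.add_const _
  have h := (hK.isSubadditiveCocycle_log hd).ae_limsup_eq hm hν
  refine isLargestLyapunovExponent_largestLyapunovExponent (a := (⨅ n : ℕ+, (n : ℝ)⁻¹ *
    ∫ x, (Real.log ‖mfderiv (𝓡 d) (𝓡 d) T^[(n : ℕ)] x‖ + (n : ℕ) * K) ∂ν) - K) ?_
  filter_upwards [h] with x hx
  rw [← hx, hK.limsup_log_add hd hK0, add_sub_cancel_right]
  exact hK.isGreatest_lyapunovExponent hd hK0 x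

theorem Ergodic.max_largestLyapunovExponent_eq (hd : 1 ≤ d) {ν : Measure M}
    [IsProbabilityMeasure ν] (hν : Ergodic T ν) :
    max (largestLyapunovExponent (d := d) T ν) 0 = ⨅ n : ℕ+, (n : ℝ)⁻¹ *
      ∫ x, Real.posLog ‖mfderiv (𝓡 d) (𝓡 d) T^[(n : ℕ)] x‖ ∂ν := by
  obtain ⟨K, hK0, hK⟩ := exists_norm_mfderiv_iterate_le hd T
  replace hK : IsExpansionBound T K := hK
  have h := (hK.isSubadditiveCocycle_posLog hd).ae_limsup_eq
    (fun n ↦ (continuous_posLog_norm_mfderiv hd n).measurable) hν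
  -- Both sides are constants, so comparison at a single generic point suffices.
  obtain ⟨x, hx1, hx2⟩ := (h.and (hν.isLargestLyapunovExponent hd)).exists
  rw [← hx1, hK.limsup_posLog hd hK0,
    (hK.isGreatest_lyapunovExponent hd hK0 x).unique hx2]

end Exponents

/-! ### The harmonic extension of $\chi_0^+$. -/

theorem lemma3 {d : ℕ} (hd : 1 ≤ d)
    {M : Type*} [TopologicalSpace M] [T2Space M] [CompactSpace M]
    [ChartedSpace (EuclideanSpace ℝ (Fin d)) M] [IsManifold (𝓡 d) 1 M]
    [RiemannianBundle (fun x : M ↦ TangentSpace (𝓡 d) x)]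
    [IsContinuousRiemannianBundle (EuclideanSpace ℝ (Fin d))
      (fun x : M ↦ TangentSpace (𝓡 d) x)]
    [MeasurableSpace M] [BorelSpace M]
    (T : M ≃ₘ^1⟮𝓡 d, 𝓡 d⟯ M) :
    -- the objects are well defined
    (∀ ν : InvariantMeasure T, Ergodic T ν.toMeasure →
      IsLargestLyapunovExponent (d := d) T ν.toMeasure
        (largestLyapunovExponent (d := d) T ν.toMeasure)) ∧
    (∀ μ : InvariantMeasure T,
      (∃ P : Measure (InvariantMeasure T), μ.IsErgodicDecomposition P) ∧
      ∀ P : Measure (InvariantMeasure T), μ.IsErgodicDecomposition P →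
        Integrable (chiZeroPlus (d := d) T) P ∧
        InvariantMeasure.harmonicExtension (chiZeroPlus (d := d) T) μ =
          ∫ ν, chiZeroPlus (d := d) T ν ∂P) ∧
    -- the formula
    (∀ μ : InvariantMeasure T,
      InvariantMeasure.harmonicExtension (chiZeroPlus (d := d) T) μ =
        ⨅ n : ℕ+, (n : ℝ)⁻¹ *
          ∫ x, Real.posLog ‖mfderiv (𝓡 d) (𝓡 d) T^[(n : ℕ)] x‖ ∂μ.toMeasure) ∧
    -- upper semicontinuity
    UpperSemicontinuous (InvariantMeasure.harmonicExtension (chiZeroPlus (d := d) T)) := by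
  have : SecondCountableTopology M :=
    ChartedSpace.secondCountable_of_sigmaCompact (EuclideanSpace ℝ (Fin d)) M
  let _ := TopologicalSpace.metrizableSpaceMetric M
  obtain ⟨K, hK0, hK⟩ := exists_norm_mfderiv_iterate_le hd T
  replace hK : IsExpansionBound T K := hK
  have hcoc := hK.isSubadditiveCocycle_posLog hd
  have hcont := continuous_posLog_norm_mfderiv (T := T) hd
  have hae : ∀ (μ : InvariantMeasure T) (P : Measure (InvariantMeasure T)),
      μ.IsErgodicDecomposition P → (fun ν : InvariantMeasure T ↦ ⨅ n : ℕ+, (n : ℝ)⁻¹ *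
        ∫ x, Real.posLog ‖mfderiv (𝓡 d) (𝓡 d) T^[(n : ℕ)] x‖ ∂ν.toMeasure) =ᵐ[P]
        chiZeroPlus (d := d) T := fun μ P hP ↦
    hP.ae_ergodic.mono fun ν hν ↦ (hν.max_largestLyapunovExponent_eq hd).symm
  have hint : ∀ (μ : InvariantMeasure T) (P : Measure (InvariantMeasure T)),
      μ.IsErgodicDecomposition P → ∫ ν, chiZeroPlus (d := d) T ν ∂P = ⨅ n : ℕ+, (n : ℝ)⁻¹ *
        ∫ x, Real.posLog ‖mfderiv (𝓡 d) (𝓡 d) T^[(n : ℕ)] x‖ ∂μ.toMeasure := fun μ P hP ↦ by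
    rw [← integral_congr_ae (hae μ P hP)]
    exact InvariantMeasure.IsErgodicDecomposition.integral_iInf_inv_mul_integral hcoc hcont hP
  have hex := InvariantMeasure.exists_isErgodicDecomposition (T := T) T.continuous
  have hharm : ∀ μ : InvariantMeasure T,
      InvariantMeasure.harmonicExtension (chiZeroPlus (d := d) T) μ = ⨅ n : ℕ+, (n : ℝ)⁻¹ *
        ∫ x, Real.posLog ‖mfderiv (𝓡 d) (𝓡 d) T^[(n : ℕ)] x‖ ∂μ.toMeasure := fun μ ↦ by
    -- The decomposition selected by choice is treated by `hint`, which holds for all of them.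
    rw [InvariantMeasure.harmonicExtension, dif_pos (hex μ)]
    exact hint μ _ (hex μ).choose_spec
  refine ⟨fun ν hν ↦ hν.isLargestLyapunovExponent hd, fun μ ↦ ⟨hex μ, fun P hP ↦ ⟨?_, ?_⟩⟩,
    hharm, ?_⟩
  · have := hP.isProbabilityMeasure
    exact (InvariantMeasure.integrable_iInf_inv_mul_integral hcoc hcont P).congr (hae μ P hP)
  · rw [hharm, hint μ P hP]
  · rw [funext hharm]
    exact InvariantMeasure.upperSemicontinuous_iInf_inv_mul_integral hcoc hcont
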